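/- **Notation.** Let $\mathscr H$ be a complex Hilbert space. For $T\in\mathcal B(\mathscr H)$ let $\mathscr H_\infty(T)=\bigcap_{n\ge 0}T^n\mathscr H$ (this is a closed subspace when $T$ is an isometry). For a closed subspace $\mathscr M$ of $\mathscr H$, $P_{\mathscr M}$ is the orthogonal projection onto $\mathscr M$. We say that $\mathscr M$ *reduces* $T$ if $\mathscr M$ and $\mathscr H\ominus\mathscr M$ are invariant for $T$, and that it reduces $T$ *to an isometry* if moreover $T|_{\mathscr M}$ is an isometry. It *essentially reduces* $T$ if $P_{\mathscr M}T|_{\mathscr H\ominus\mathscr M}$ and $P_{\mathscr H\ominus\mathscr M}T|_{\mathscr M}$ are compact, and it essentially reduces $T$ *to an isometry* if moreover $P_{\mathscr M}T|_{\mathscr M}\in\mathcal B(\mathscr M)$ is an isometry. A *bi-isometry* (resp. *bi-unitary*) is a commuting pair of isometries (resp. unitaries); a commuting pair $(A,B)$ is *doubly commuting* if $A^*B=BA^*$. $\mathscr M$ reduces a pair $(A,B)$ to a doubly commuting bi-isometry if it reduces $A$ and $B$ and $(A|_{\mathscr M},B|_{\mathscr M})$ is a doubly commuting bi-isometry. $\bigvee$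 denotes the closed linear span. For a complex Hilbert space $E$, $\mathscr H^2_E(\mathbb D)$ is the Hardy space of holomorphic functions $f(z)=\sum_{n\ge0}a_nz^n$ on the open unit disc $\mathbb D$, $a_n\in E$, with $\|f\|^2=\sum_n\|a_n\|^2<\infty$, and $M_{\phi,E}$ is the operator $(M_{\phi,E}f)(z)=\phi(z)f(z)$ on it. An *inner function* $\phi:\mathbb D\to\mathcal B(E)$ is a bounded holomorphic function whose strong radial boundary value $\phi(\zeta)=\lim_{r\to1^-}\phi(r\zeta)$ exists and is an isometry for almost every $\zeta$ in the unit circle. (If $E$ is not separable, this is understood on each separable subspace $M$ of $E$: for almost every $\zeta$, with exceptional null set depending on $M$, the limit of $\phi(r\zeta)x$ exists for all $x\in M$ and defines an isometry $M\to E$.) **Theorem.** Let $(S_1,S_2)$ be a bi-isometry on $\mathscr H$, let $\mathscr E=\ker S_1^*$ and let $P_\infty$ be the orthogonal projection of $\mathscr H$ onto $\mathscr H_\infty(S_1)$. The following statements are equivalent: (i) $\mathscr H_\infty(S_1)$ reduces $S_2$ to an isometry; (ii) $\mathscr H_\infty(S_1)$ reduces $(S_1,S_2)$ to a doubly commuting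 bi-isometry; (iii) $S_2(\mathscr E)$ and $\mathscr H_\infty(S_1)$ are orthogonal subspaces of $\mathscr H$; (iv) $P_\infty\bigvee\{S_1^{*k}S_2x : k\ge 1\}$ is finite-dimensional for every $x\in\mathscr E$; (v) $\mathscr H_\infty(S_1)$ essentially reduces $S_2$ to an isometry. If (i) holds, then there exist an inner function $\phi:\mathbb D\to\mathcal B(\mathscr E)$, a Hilbert space $\mathscr F$, a constant unitary operator-valued function $\psi:\mathbb D\to\mathcal B(\mathscr F)$, a closed subspace $\mathscr H_{uu}$ of $\mathscr H_\infty(S_1)$ and a bi-unitary $(V_1,V_2)$ on $\mathscr H_{uu}$ such that $(S_1,S_2)$ is unitarily equivalent to $$(V_1,V_2)\oplus(M_{\psi,\mathscr F},M_{z,\mathscr F})\oplus(M_{z,\mathscr E},M_{\phi,\mathscr E})\quad\text{on}\quad \mathscr H_{uu}\oplus\mathscr H^2_{\mathscr F}(\mathbb D)\oplus\mathscr H^2_{\mathscr E}(\mathbb D).$$ -/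

import Mathlib

open scoped Topology
open ContinuousLinearMap (adjoint)

universe u

noncomputable section

section Operators

variable {H : Type*} [NormedAddCommGroup H] [InnerProductSpace ℂ H]

/-- The hyper-range `⋂ₙ Tⁿ H` of a bounded operator `T`. -/
def hyperRange (T : H →L[ℂ] H) : Submodule ℂ H :=
  ⨅ n : ℕ, LinearMap.range ((T ^ n : H →L[ℂ] H) : H →ₗ[ℂ] H)

/-- `T` is an isometry: `T* T = I`. -/
def IsIsometryOp [CompleteSpace H] (T : H →L[ℂ] H) : Prop :=
  adjoint T * T = 1

/-- A bi-isometry: a commuting pair of isometries. -/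
def IsBiIsometry [CompleteSpace H] (A B : H →L[ℂ] H) : Prop :=
  A * B = B * A ∧ IsIsometryOp A ∧ IsIsometryOp B

/-- A bi-unitary: a commuting pair of unitary operators. -/
def IsBiUnitary [CompleteSpace H] (A B : H →L[ℂ] H) : Prop :=
  A * B = B * A ∧ A ∈ unitary (H →L[ℂ] H) ∧ B ∈ unitary (H →L[ℂ] H)

/-- A doubly commuting pair: `A B = B A` and `A* B = B A*`. -/
def IsDoublyCommuting [CompleteSpace H] (A B : H →L[ℂ] H) : Prop :=
  A * B = B * A ∧ adjoint A * B = B * adjoint A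

/-- The powers of an isometry are isometric maps. -/
theorem IsIsometryOp.isometry_pow [CompleteSpace H] {T : H →L[ℂ] H} (hT : IsIsometryOp T)
    (n : ℕ) : Isometry (T ^ n : H →L[ℂ] H) := by
  have h1 : ∀ x, ‖T x‖ = ‖x‖ := by
    intro x
    have h2 : inner ℂ (T x) (T x) = inner ℂ x x := by
      rw [← ContinuousLinearMap.adjoint_inner_left]
      have h3 : adjoint T (T x) = x := by
        simpa using congrArg (fun A : H →L[ℂ] H => A x) hT
      rw [h3]
    rw [inner_self_eq_norm_sq_to_K, inner_self_eq_norm_sq_to_K] at h2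
    have h4 : ‖T x‖ ^ 2 = ‖x‖ ^ 2 := by exact_mod_cast h2
    exact (pow_left_inj₀ (norm_nonneg _) (norm_nonneg _) two_ne_zero).1 h4
  refine AddMonoidHomClass.isometry_of_norm _ fun x => ?_
  induction n with
  | zero => simp
  | succ k ih => rw [pow_succ', mul_apply_eq_comp, h1, ih]

/-- The hyper-range of an isometry is closed, hence a Hilbert space. -/
theorem IsIsometryOp.completeSpace_hyperRange [CompleteSpace H] {T : H →L[ℂ] H}
    (hT : IsIsometryOp T) : CompleteSpace (hyperRange T) := by
  have h : IsClosed (hyperRange T : Set H) := by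
    have h1 : (hyperRange T : Set H) = ⋂ n : ℕ, Set.range (T ^ n : H →L[ℂ] H) := by
      ext x
      simp only [hyperRange, Submodule.coe_iInf, Set.mem_iInter, SetLike.mem_coe,
        LinearMap.mem_range, Set.mem_range, ContinuousLinearMap.coe_coe]
    rw [h1]
    exact isClosed_iInter fun n => (hT.isometry_pow n).isClosedEmbedding.isClosed_range
  exact h.completeSpace_coe

/-- `M` is invariant for `T`. -/
def InvariantFor (M : Submodule ℂ H) (T : H →L[ℂ] H) : Prop :=
  ∀ x ∈ M, T x ∈ M

/-- `M` reduces `T`: both `M` and `H ⊖ M` are invariant for `T`. -/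
def Reduces (M : Submodule ℂ H) (T : H →L[ℂ] H) : Prop :=
  InvariantFor M T ∧ InvariantFor Mᗮ T

/-- The restriction `T|_M ∈ B(M)` of `T` to an invariant subspace `M`. -/
def restrictOp (M : Submodule ℂ H) (T : H →L[ℂ] H) (h : InvariantFor M T) : M →L[ℂ] M :=
  (T ∘L M.subtypeL).codRestrict M fun x => h x x.2

/-- The block `P_N T|_M ∈ B(M, N)` of `T`. -/
def blockOp (M N : Submodule ℂ H) [N.HasOrthogonalProjection] (T : H →L[ℂ] H) : M →L[ℂ] N :=
  N.orthogonalProjectionOnto ∘L T ∘L M.subtypeL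

/-- `M` reduces `T` to an isometry. -/
def ReducesToIsometry (M : Submodule ℂ H) [CompleteSpace M] (T : H →L[ℂ] H) : Prop :=
  ∃ h : Reduces M T, IsIsometryOp (restrictOp M T h.1)

/-- `M` reduces the pair `(A, B)` to a doubly commuting bi-isometry. -/
def ReducesToDoublyCommutingBiIsometry (M : Submodule ℂ H) [CompleteSpace M]
    (A B : H →L[ℂ] H) : Prop :=
  ∃ (hA : Reduces M A) (hB : Reduces M B),
    IsBiIsometry (restrictOp M A hA.1) (restrictOp M B hB.1) ∧
    IsDoublyCommuting (restrictOp M A hA.1) (restrictOp M B hB.1)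

/-- `M` essentially reduces `T`: the off-diagonal blocks `P_M T|_{H ⊖ M}` and
`P_{H ⊖ M} T|_M` are compact. -/
def EssentiallyReduces (M : Submodule ℂ H) [CompleteSpace M] (T : H →L[ℂ] H) : Prop :=
  IsCompactOperator (blockOp Mᗮ M T) ∧ IsCompactOperator (blockOp M Mᗮ T)

/-- `M` essentially reduces `T` to an isometry: moreover the diagonal block `P_M T|_M` (which is
`T|_M` when `M` is invariant for `T`) is an isometry. -/
def EssentiallyReducesToIsometry (M : Submodule ℂ H) [CompleteSpace M]
    (T : H →L[ℂ] H) : Prop :=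
  EssentiallyReduces M T ∧ IsIsometryOp (blockOp M M T)

/-- The closed linear span `⋁ {A*ᵏ B x : k ≥ 1}`. -/
def adjointOrbitSpan [CompleteSpace H] (A B : H →L[ℂ] H) (x : H) : Submodule ℂ H :=
  (Submodule.span ℂ {y : H | ∃ k : ℕ, 1 ≤ k ∧ y = (adjoint A ^ k) (B x)}).topologicalClosure

/-- The orthogonal direct sum `A ⊕ B` of two operators, on the Hilbert space direct sum. -/
def opSum {K : Type*} [NormedAddCommGroup K] [InnerProductSpace ℂ K]
    (A : H →L[ℂ] H) (B : K →L[ℂ] K) : WithLp 2 (H × K) →L[ℂ] WithLp 2 (H × K) :=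
  ((WithLp.prodContinuousLinearEquiv 2 ℂ H K).symm : (H × K) →L[ℂ] WithLp 2 (H × K)) ∘L
    (A.prodMap B) ∘L
    ((WithLp.prodContinuousLinearEquiv 2 ℂ H K) : WithLp 2 (H × K) →L[ℂ] (H × K))

/-- The pairs `(A₁, A₂)` on `H` and `(B₁, B₂)` on `K` are (simultaneously) unitarily equivalent. -/
def PairUnitarilyEquivalent {K : Type*} [NormedAddCommGroup K] [InnerProductSpace ℂ K]
    (A₁ A₂ : H →L[ℂ] H) (B₁ B₂ : K →L[ℂ] K) : Prop :=
  ∃ W : H ≃ₗᵢ[ℂ] K, ∀ x : H, W (A₁ x) = B₁ (W x) ∧ W (A₂ x) = B₂ (W x)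

end Operators

section Hardy

/-- The Hardy space `H²_E(𝔻)` of the functions `f(z) = ∑ aₙ zⁿ` on the unit disc with
coefficients `aₙ ∈ E` such that `‖f‖² = ∑ ‖aₙ‖² < ∞`, each function being recorded by its
sequence of Taylor coefficients. -/
abbrev HardySpace (E : Type*) [NormedAddCommGroup E] : Type _ :=
  lp (fun _ : ℕ => E) 2

variable {E : Type*} [NormedAddCommGroup E] [InnerProductSpace ℂ E]

/-- The value at `z ∈ 𝔻` of a function in the Hardy space. -/
def hardyEval (f : HardySpace E) (z : ℂ) : E :=
  ∑' n : ℕ, z ^ n • f n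

/-- The power series of a function in the Hardy space. -/
def hardySeries (f : HardySpace E) : FormalMultilinearSeries ℂ ℂ E :=
  fun n => ContinuousMultilinearMap.mkPiRing ℂ (Fin n) (f n)

/-- A function in the Hardy space is given on the open unit disc by its convergent power series;
in particular it is holomorphic there. -/
theorem hardyEval_hasFPowerSeriesOnBall [CompleteSpace E] (f : HardySpace E) :
    HasFPowerSeriesOnBall (hardyEval f) (hardySeries f) 0 1 := by
  have hr : 1 ≤ (hardySeries f).radius := by
    refine (hardySeries f).le_radius_of_bound (r := 1) ‖f‖ fun n => ?_
    simpa [hardySeries] using lp.norm_apply_le_norm two_ne_zero f n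
  refine ⟨hr, one_pos, fun {y} hy => ?_⟩
  have h := (hardySeries f).hasSum (x := y) (Metric.eball_subset_eball hr hy)
  have h2 : ∀ n, (hardySeries f n fun _ => y) = y ^ n • f n := by
    intro n
    simp [hardySeries]
  simp only [h2] at h
  simp only [h2, zero_add]
  exact h.summable.hasSum

/-- An element of the Hardy space is determined by its values on the open unit disc. -/
theorem hardyEval_injective [CompleteSpace E] {f g : HardySpace E}
    (h : ∀ z ∈ Metric.ball (0 : ℂ) 1, hardyEval f z = hardyEval g z) : f = g := by
  have hf := (hardyEval_hasFPowerSeriesOnBall f).hasFPowerSeriesAt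
  have hg := (hardyEval_hasFPowerSeriesOnBall g).hasFPowerSeriesAt
  have he : hardyEval f =ᶠ[𝓝 0] hardyEval g :=
    Filter.eventually_of_mem (Metric.ball_mem_nhds 0 one_pos) h
  have hs := (hf.congr he).eq_formalMultilinearSeries hg
  ext n
  have := congrArg (fun p : FormalMultilinearSeries ℂ ℂ E => p n fun _ => 1) hs
  simpa [hardySeries] using this

/-- `T` is the operator `M_φ` on `H²_E(𝔻)` of multiplication by the operator-valued function `φ`,
that is, `(T f)(z) = φ(z) f(z)` for all `z ∈ 𝔻`; at most one `T` has this property. -/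
def IsMulOp (φ : ℂ → (E →L[ℂ] E)) (T : HardySpace E →L[ℂ] HardySpace E) : Prop :=
  ∀ f : HardySpace E, ∀ z ∈ Metric.ball (0 : ℂ) 1, hardyEval (T f) z = φ z (hardyEval f z)

/-- The function `z ↦ z I`, whose multiplication operator is `M_z`. -/
def coordFun (E : Type*) [NormedAddCommGroup E] [InnerProductSpace ℂ E] :
    ℂ → (E →L[ℂ] E) :=
  fun z => z • ContinuousLinearMap.id ℂ E

/-- `φ` is in `H^∞_{B(E)}(𝔻)`: a bounded holomorphic function on `𝔻` with values in `B(E)`. -/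
def IsBoundedHolomorphic (φ : ℂ → (E →L[ℂ] E)) : Prop :=
  DifferentiableOn ℂ φ (Metric.ball 0 1) ∧
    ∃ C : ℝ, ∀ z ∈ Metric.ball (0 : ℂ) 1, ‖φ z‖ ≤ C

/-- `φ` is an inner function: it is bounded and holomorphic, and its strong radial boundary value
`φ(ζ)` is an isometry for almost every `ζ = e^{iθ}` on the unit circle. If `E` is separable, this
is the case `M = E` of the condition below (which implies the others). If `E` is not separable,
the boundary value at a given point need not exist on all of `E`, and the condition is imposed on
each separable subspace `M`, with an exceptional set of measure zero that may depend on `M`. -/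
def IsInner (φ : ℂ → (E →L[ℂ] E)) : Prop :=
  IsBoundedHolomorphic φ ∧
    ∀ M : Submodule ℂ E, TopologicalSpace.IsSeparable (M : Set E) →
      ∀ᵐ θ : ℝ, ∃ V : M →ₗᵢ[ℂ] E, ∀ x : M,
        Filter.Tendsto (fun r : ℝ => φ ((r : ℂ) * Complex.exp (θ * Complex.I)) x)
          (𝓝[<] 1) (𝓝 (V x))

/-- `ψ` is, on the disc, a constant function whose value is a unitary operator. -/
def IsConstUnitary [CompleteSpace E] (ψ : ℂ → (E →L[ℂ] E)) : Prop :=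
  ∃ U ∈ unitary (E →L[ℂ] E), ∀ z ∈ Metric.ball (0 : ℂ) 1, ψ z = U

end Hardy

end

/-! ### Radial limits of derivatives through the Poisson kernel. -/

section RadialLimits

open Metric Filter

variable {E : Type*} [NormedAddCommGroup E] [NormedSpace ℂ E]

/-! Write `M` for the hyper-range of `S₁` and `E` for the kernel of `S₁*`. By the Wold decomposition
(`range_wold`), `Mᗮ` is the orthogonal sum of the spaces `S₁ⁿ E`, and `S₁` is unitary on `M`.
Commutation alone makes `M` invariant for `S₂`, so (i) only asks that `S₂` preserve `Mᗮ`. Since `S₂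
S₁ⁿ = S₁ⁿ S₂`, this is decided on `E`, which is (iii) (`reduces_of_isOrtho`). Double commutation on
`M` is then automatic, because what commutes with a unitary commutes with its adjoint.

The conditions (iv) and (v) give (iii) by recurrence. For `x ∈ E` split `S₂ x = y + w` along `M` and
`Mᗮ`. For `k ≥ 1` one has `⟨S₁ᵏ S₂ x, S₂ x⟩ = ⟨S₁ᵏ x, x⟩ = 0`, hence `⟨S₁ᵏ y, y⟩ = -⟨S₁ᵏ w, w⟩`, and
this tends to `0` since `S₁*ᵏ → 0` strongly on `Mᗮ` (`tendsto_inner_pow_starProjection`). Finite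
dimension or compactness puts a backward or forward orbit of `y` into a compact set, so two of its
points are close, with an arbitrarily long gap `k` between them. As `S₁` is unitary on `M`, this
says that `S₁ᵏ y` is close to `y`. With the decay of `⟨S₁ᵏ y, y⟩`, it forces `y = 0`
(`eq_zero_of_recurrent`).

For the model (`exists_model`), the Wold isometry of `S₁` turns `S₁` on `Mᗮ` into `M_z` and `S₂`
into an isometry commuting with `M_z`, that is, multiplication by its symbol `φ`. A second Wold
decomposition, of `S₂` on `M`, yields the summand over `F`. There `S₁` doubly commutes with the
shift, so it is a constant unitary. What remains is the hyper-range of `S₁ S₂`, on which both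
operators are unitary.

That `φ` is inner rests on Fatou's theorem for Hilbert space valued functions. The primitive of a
Hardy function is continuous on the closed disc, and on the circle it is an indefinite integral of
an `L²` function, hence differentiable almost everywhere. A Poisson estimate turns this tangential
derivative into a radial limit (`tendsto_deriv_radial`). The limits have full norm because `φ` is
contractive and the `L²` norm leaves no room for loss. -/

theorem continuousOn_poissonKernel_sphere {w : ℂ} (hw : w ∈ ball (0 : ℂ) 1) :
    ContinuousOn (poissonKernel 0 w) (sphere (0 : ℂ) 1) := by
  have h : ∀ z ∈ sphere (0 : ℂ) 1, ‖z - w‖ ^ 2 ≠ 0 := by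
    intro z hz h0
    have : z = w := by simpa [sub_eq_zero] using h0
    simp_all
  have h2 : poissonKernel 0 w = fun z => (‖z‖ ^ 2 - ‖w‖ ^ 2) / ‖z - w‖ ^ 2 := by
    ext z; simp [poissonKernel_def]
  rw [h2]
  exact ContinuousOn.div (by fun_prop) (by fun_prop) h

/-- This is the Poisson formula for the constant `1`; taking real parts turns the complex average
into a real one. -/
theorem circleAverage_poissonKernel {w : ℂ} (hw : w ∈ ball (0 : ℂ) 1) :
    Real.circleAverage (poissonKernel 0 w) 0 1 = 1 := by
  have h := (diffContOnCl_const (c := (1 : ℂ))).circleAverage_poissonKernel_smul hw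
  have h2 := ContinuousLinearMap.circleAverage_comp_comm Complex.reCLM (c := 0) (R := 1)
    (f := poissonKernel 0 w • fun _ => (1 : ℂ)) (by
      refine ContinuousOn.circleIntegrable zero_le_one ?_
      exact (continuousOn_poissonKernel_sphere hw).smul continuousOn_const)
  rw [h] at h2
  simp only [Complex.reCLM_apply, Complex.one_re] at h2
  rw [← h2]
  congr 1
  ext z
  simp

/-- A two-constant estimate near the boundary point `1`, from the Poisson integral. -/
theorem DiffContOnCl.norm_le_of_norm_le_near_one [CompleteSpace E] {q : ℂ → E}
    (hq : DiffContOnCl ℂ q (ball 0 1))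
    {ε B δ : ℝ} (hε : 0 ≤ ε) (hδ : 0 < δ) (hB : ∀ z ∈ sphere (0 : ℂ) 1, ‖q z‖ ≤ B)
    (hn : ∀ z ∈ sphere (0 : ℂ) 1, ‖z - 1‖ < δ → ‖q z‖ ≤ ε) {w : ℂ} (hw : w ∈ ball (0 : ℂ) 1)
    (hw1 : ‖w - 1‖ ≤ δ / 2) : ‖q w‖ ≤ ε + B * (8 * ‖w - 1‖ / δ ^ 2) := by
  have hB0 : 0 ≤ B := (norm_nonneg _).trans (hB 1 (by simp))
  have hwn : ‖w‖ < 1 := by simpa using hw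
  have hP : ∀ z ∈ sphere (0 : ℂ) 1, 0 ≤ poissonKernel 0 w z := by
    intro z hz
    have hz1 : ‖z‖ = 1 := by simpa using hz
    rw [poissonKernel_def]
    simp only [sub_zero, hz1]
    have : ‖w‖ ^ 2 ≤ 1 := by nlinarith [norm_nonneg w]
    exact div_nonneg (by linarith) (by positivity)
  have hPfar : ∀ z ∈ sphere (0 : ℂ) 1, δ ≤ ‖z - 1‖ →
      poissonKernel 0 w z ≤ 8 * ‖w - 1‖ / δ ^ 2 := by
    intro z hz hzδ
    have hz1 : ‖z‖ = 1 := by simpa using hz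
    rw [poissonKernel_def]
    simp only [sub_zero, hz1]
    have h1 : δ / 2 ≤ ‖z - w‖ := by
      have := norm_sub_le_norm_sub_add_norm_sub z w 1
      linarith
    have h2 : 1 - ‖w‖ ≤ ‖w - 1‖ := by
      have := norm_sub_norm_le 1 w
      rw [norm_sub_rev] at this
      simpa using this
    have h3 : (1 : ℝ) ^ 2 - ‖w‖ ^ 2 ≤ 2 * ‖w - 1‖ := by nlinarith [norm_nonneg w]
    calc ((1 : ℝ) ^ 2 - ‖w‖ ^ 2) / ‖z - w‖ ^ 2 ≤ 2 * ‖w - 1‖ / (δ / 2) ^ 2 := by gcongr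
      _ = _ := by ring
  have hci : CircleIntegrable (poissonKernel 0 w) 0 1 :=
    (continuousOn_poissonKernel_sphere hw).circleIntegrable zero_le_one
  have hqs : ContinuousOn q (sphere (0 : ℂ) 1) :=
    hq.continuousOn_ball.mono sphere_subset_closedBall
  have hnorm : ‖q w‖ ≤ Real.circleAverage (fun z => ‖(poissonKernel 0 w • q) z‖) 0 1 := by
    conv_lhs => rw [← hq.circleAverage_poissonKernel_smul hw]
    rw [Real.circleAverage_def, Real.circleAverage_def, norm_smul,
      Real.norm_of_nonneg (by positivity), smul_eq_mul]
    gcongr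
    exact intervalIntegral.norm_integral_le_integral_norm Real.two_pi_pos.le
  refine hnorm.trans ?_
  have hmono : Real.circleAverage (fun z => ‖(poissonKernel 0 w • q) z‖) 0 1 ≤
      Real.circleAverage (fun z => ε • poissonKernel 0 w z + B * (8 * ‖w - 1‖ / δ ^ 2)) 0 1 := by
    apply Real.circleAverage_mono
    · refine ContinuousOn.circleIntegrable zero_le_one ?_
      exact ((continuousOn_poissonKernel_sphere hw).smul hqs).norm
    · refine ContinuousOn.circleIntegrable zero_le_one ?_
      exact ((continuousOn_poissonKernel_sphere hw).const_smul ε).add continuousOn_const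
    · intro z hz
      rw [abs_one] at hz
      have hPz := hP z hz
      rw [Pi.smul_apply', norm_smul, Real.norm_of_nonneg hPz, smul_eq_mul]
      rcases lt_or_ge ‖z - 1‖ δ with h | h
      · have := mul_le_mul_of_nonneg_left (hn z hz h) hPz
        have h2 : 0 ≤ B * (8 * ‖w - 1‖ / δ ^ 2) := by positivity
        linarith
      · have h1 := mul_le_mul (hPfar z hz h) (hB z hz) (norm_nonneg _) (by positivity)
        have h2 : 0 ≤ ε * poissonKernel 0 w z := by positivity
        linarith
  refine hmono.trans (le_of_eq ?_)
  rw [Real.circleAverage_fun_add, Real.circleAverage_fun_smul, circleAverage_poissonKernel hw,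
    Real.circleAverage_const]
  · simp
  · exact hci.const_smul
  · exact circleIntegrable_const _ _ _

/-- The derivative at `0` of a function of the angle, in terms of the points of the circle. -/
theorem hasDerivAt_circle_zero_isLittleO {k : ℂ → E}
    (hd : HasDerivAt (fun θ : ℝ => k (Complex.exp (θ * Complex.I))) 0 0) {ε : ℝ} (hε : 0 < ε) :
    ∃ δ > 0, ∀ z ∈ sphere (0 : ℂ) 1, ‖z - 1‖ < δ → ‖k z - k 1‖ ≤ ε * ‖z - 1‖ := by
  rw [hasDerivAt_iff_isLittleO] at hd
  -- The factor `2 / π` pays for Jordan's inequality `‖z - 1‖ = 2 |sin (arg z / 2)| ≥ (2 / π) |arg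
  -- z|`.
  have h1 := hd.def (c := ε * (2 / Real.pi)) (by positivity)
  have harg : Tendsto Complex.arg (𝓝 1) (𝓝 0) := by
    have := (Complex.continuousAt_arg (x := 1) (by simp)).tendsto
    simpa using this
  have h2 := harg.eventually h1
  rw [Metric.eventually_nhds_iff] at h2
  obtain ⟨δ, hδ, h2⟩ := h2
  refine ⟨δ, hδ, fun z hz hzδ => ?_⟩
  have h3 := h2 (y := z) (by rwa [dist_eq_norm])
  have hz1 : ‖z‖ = 1 := by simpa using hz
  have hez : Complex.exp (z.arg * Complex.I) = z := by
    have := Complex.norm_mul_exp_arg_mul_I z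
    rwa [hz1, Complex.ofReal_one, one_mul] at this
  simp only [hez, Complex.ofReal_zero, zero_mul, Complex.exp_zero, smul_zero, sub_zero] at h3
  refine h3.trans ?_
  have h4 : 2 / Real.pi * |z.arg| ≤ ‖z - 1‖ := by
    have hz2 : ‖z - 1‖ = ‖Complex.exp (Complex.I * z.arg) - 1‖ := by rw [mul_comm, hez]
    rw [hz2, Complex.norm_exp_I_mul_ofReal_sub_one, norm_mul, Real.norm_ofNat, Real.norm_eq_abs]
    have h5 := Real.mul_abs_le_abs_sin (x := z.arg / 2) (by
      rw [abs_div, abs_two]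
      have := Complex.abs_arg_le_pi z
      linarith)
    rw [abs_div, abs_two] at h5
    linarith
  rw [Real.norm_eq_abs, mul_assoc]
  gcongr

/-- If the boundary function of `k` is differentiable at `1` along the circle with derivative zero,
then `k'` has radial limit zero at `1`. -/
theorem tendsto_deriv_radial_zero [CompleteSpace E] {k : ℂ → E} (hk : DiffContOnCl ℂ k (ball 0 1))
    (hk1 : k 1 = 0) (hd : HasDerivAt (fun θ : ℝ => k (Complex.exp (θ * Complex.I))) 0 0) :
    Tendsto (fun r : ℝ => deriv k r) (𝓝[<] 1) (𝓝 0) := by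
  obtain ⟨C, hC⟩ := (isCompact_closedBall (0 : ℂ) 1).exists_bound_of_continuousOn
    hk.continuousOn_ball
  rw [NormedAddGroup.tendsto_nhds_zero]
  intro η hη
  -- Cauchy's estimate at the end yields the bound `6 ε`, which is strictly below `7 ε = η`.
  set ε := η / 7 with hεdef
  have hε : 0 < ε := by positivity
  obtain ⟨δ, hδ, hnear⟩ := hasDerivAt_circle_zero_isLittleO hd hε
  have hC0 : 0 ≤ C := (norm_nonneg _).trans (hC 0 (by simp))
  -- A bound on the whole circle for the difference quotient of `k`: `ε` within `δ` of the point
  -- `1`, and `C / δ` elsewhere.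
  set B := max ε (C / δ) with hBdef
  have hB0 : 0 ≤ B := hε.le.trans (le_max_left _ _)
  -- the difference quotient at `1` is small near `1`
  have key : ∀ w ∈ ball (0 : ℂ) 1, ‖w - 1‖ ≤ δ / 2 →
      ‖k w‖ ≤ (ε + B * (8 * ‖w - 1‖ / δ ^ 2)) * ‖w - 1‖ := by
    intro w hw hw1
    -- The quotient `k z / (z - 1)` may be singular at `1`. Moving the pole to `s > 1` makes it
    -- continuous on the closed disc without enlarging it on the circle; then `s` tends to `1`.
    have hs : ∀ s : ℝ, 1 < s → ‖k w‖ ≤ (ε + B * (8 * ‖w - 1‖ / δ ^ 2)) * ‖w - s‖ := by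
      intro s hs
      have hns : ∀ z : ℂ, ‖z‖ ≤ 1 → z - s ≠ 0 := by
        intro z hz h0
        rw [sub_eq_zero.1 h0, Complex.norm_real, Real.norm_of_nonneg (by linarith)] at hz
        linarith
      have hge : ∀ z ∈ sphere (0 : ℂ) 1, ‖z - 1‖ ≤ ‖z - s‖ := by
        intro z hz
        have hz1 : ‖z‖ = 1 := by simpa using hz
        have hre : z.re ≤ 1 := hz1 ▸ Complex.re_le_norm z
        rw [Complex.norm_eq_sqrt_sq_add_sq, Complex.norm_eq_sqrt_sq_add_sq]
        apply Real.sqrt_le_sqrt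
        simp only [Complex.sub_re, Complex.one_re, Complex.sub_im, Complex.one_im,
          Complex.ofReal_re, Complex.ofReal_im]
        nlinarith
      have hq : DiffContOnCl ℂ (fun z => (z - (s : ℂ))⁻¹ • k z) (ball 0 1) := by
        refine DiffContOnCl.smul ?_ hk
        refine (DifferentiableOn.diffContOnCl_ball (U := closedBall 0 1) ?_ le_rfl)
        intro z hz
        have hz1 : z - s ≠ 0 := hns z (by simpa using hz)
        have : DifferentiableAt ℂ (fun z : ℂ => (z - s)⁻¹) z := by fun_prop (disch := assumption)
        exact this.differentiableWithinAt
      have hB : ∀ z ∈ sphere (0 : ℂ) 1, ‖z - 1‖ < δ → ‖(z - (s : ℂ))⁻¹ • k z‖ ≤ ε := by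
        intro z hz hzδ
        have h1 := hnear z hz hzδ
        rw [hk1, sub_zero] at h1
        have h2 := hge z hz
        have h3 : 0 < ‖z - s‖ := norm_pos_iff.2 (hns z (by simpa using hz.le))
        rw [norm_smul, norm_inv, inv_mul_le_iff₀ h3]
        nlinarith
      have := hq.norm_le_of_norm_le_near_one (B := B) hε.le hδ (fun z hz => ?_) hB hw hw1
      · have h3 : 0 < ‖w - s‖ := norm_pos_iff.2 (hns w (by simpa using (mem_ball.1 hw).le))
        rw [norm_smul, norm_inv, inv_mul_le_iff₀ h3] at this
        linarith
      · rcases lt_or_ge ‖z - 1‖ δ with h | h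
        · exact (hB z hz h).trans (le_max_left _ _)
        · refine le_trans ?_ (le_max_right _ _)
          have h3 := h.trans (hge z hz)
          rw [norm_smul, norm_inv, div_eq_inv_mul]
          gcongr
          exact hC z (by simpa using hz.le)
    have hlim : Tendsto (fun s : ℝ => (ε + B * (8 * ‖w - 1‖ / δ ^ 2)) * ‖w - s‖) (𝓝[>] 1)
        (𝓝 ((ε + B * (8 * ‖w - 1‖ / δ ^ 2)) * ‖w - (1 : ℝ)‖)) := by
      refine Tendsto.mono_left (Continuous.tendsto ?_ _) nhdsWithin_le_nhds
      fun_prop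
    rw [Complex.ofReal_one] at hlim
    exact ge_of_tendsto hlim (eventually_nhdsWithin_of_forall hs)
  have hr1 : ∀ᶠ r : ℝ in 𝓝[<] 1, 0 < r ∧ 2 * (1 - r) ≤ δ / 2 ∧
      B * (8 * (2 * (1 - r)) / δ ^ 2) < ε := by
    have h0 : ∀ᶠ r : ℝ in 𝓝 1, 0 < r := lt_mem_nhds one_pos
    have h2 : ∀ᶠ r : ℝ in 𝓝 1, 2 * (1 - r) < δ / 2 := by
      refine ContinuousAt.eventually_lt (by fun_prop) (by fun_prop) ?_
      simpa using hδ
    have h3 : ∀ᶠ r : ℝ in 𝓝 1, B * (8 * (2 * (1 - r)) / δ ^ 2) < ε := by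
      refine ContinuousAt.eventually_lt (by fun_prop) (by fun_prop) ?_
      simpa using hε
    filter_upwards [nhdsWithin_le_nhds h0, nhdsWithin_le_nhds h2, nhdsWithin_le_nhds h3]
      with r a b c using ⟨a, b.le, c⟩
  filter_upwards [hr1, self_mem_nhdsWithin] with r ⟨hr0, hr2, hr3⟩ hrlt
  have hrlt : r < 1 := hrlt
  have hρ : 0 < (1 - r) / 2 := by linarith
  have hcb : closedBall (r : ℂ) ((1 - r) / 2) ⊆ ball 0 1 := by
    intro z hz
    have h1 : ‖z - r‖ ≤ (1 - r) / 2 := by simpa [dist_eq_norm] using hz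
    have h2 := norm_sub_norm_le z r
    rw [Complex.norm_real, Real.norm_of_nonneg hr0.le] at h2
    rw [mem_ball_zero_iff]
    linarith
  -- Cauchy's estimate on the circle of radius `(1 - r) / 2` about `r`, where `‖z - 1‖ ≤ 3 (1 - r) /
  -- 2`.
  have hder := Complex.norm_deriv_le_of_forall_mem_sphere_norm_le (f := k) (c := r)
    (C := 2 * ε * (3 / 2 * (1 - r))) hρ
    ((hk.differentiableOn.mono hcb).diffContOnCl_ball le_rfl) (fun z hz => by
      have hzb := hcb (sphere_subset_closedBall hz)
      have h1 : ‖z - r‖ = (1 - r) / 2 := by simpa [dist_eq_norm] using hz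
      have h2 : ‖z - 1‖ ≤ 3 / 2 * (1 - r) := by
        have h3 := norm_sub_le_norm_sub_add_norm_sub z r 1
        have h4 : ‖(r : ℂ) - 1‖ = 1 - r := by
          rw [← Complex.ofReal_one, ← Complex.ofReal_sub, Complex.norm_real, Real.norm_eq_abs,
            abs_of_neg (by linarith)]
          ring
        linarith
      refine (key z hzb (by linarith)).trans ?_
      have h5 : B * (8 * ‖z - 1‖ / δ ^ 2) ≤ B * (8 * (2 * (1 - r)) / δ ^ 2) := by
        gcongr
        linarith
      gcongr
      linarith)
  refine hder.trans_lt ?_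
  rw [div_lt_iff₀ hρ]
  nlinarith

/-- **Fatou's theorem**, pointwise form: if the boundary function of `h` is differentiable at `1`
along the circle, then `h'` has a radial limit at `1`. -/
theorem tendsto_deriv_radial [CompleteSpace E] {h : ℂ → E} (hh : DiffContOnCl ℂ h (ball 0 1)) {c : E}
    (hd : HasDerivAt (fun θ : ℝ => h (Complex.exp (θ * Complex.I))) (Complex.I • c) 0) :
    Tendsto (fun r : ℝ => deriv h r) (𝓝[<] 1) (𝓝 c) := by
  -- Subtracting the affine function with value `h 1` at `1` and slope `c` leaves a function with
  -- value and angular derivative zero at `1`.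
  have hk : DiffContOnCl ℂ (fun z => h z - (h 1 + (z - 1) • c)) (ball 0 1) :=
    hh.sub (Differentiable.diffContOnCl (by fun_prop))
  have hexp : HasDerivAt (fun θ : ℝ => Complex.exp (θ * Complex.I)) Complex.I 0 := by
    have h1 : HasDerivAt (fun θ : ℝ => (θ : ℂ) * Complex.I) (1 * Complex.I) 0 :=
      (Complex.ofRealCLM.hasDerivAt (x := (0 : ℝ))).mul_const _
    simpa using h1.cexp
  have hlin : HasDerivAt (fun θ : ℝ => h 1 + (Complex.exp (θ * Complex.I) - 1) • c)
      (Complex.I • c) 0 := ((hexp.sub_const 1).smul_const c).const_add _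
  have h0 := tendsto_deriv_radial_zero hk (by simp) (by
    have := hd.sub hlin
    rw [sub_self] at this
    exact this)
  have h1 : Tendsto (fun r : ℝ => deriv (fun z => h z - (h 1 + (z - 1) • c)) r + c) (𝓝[<] 1)
      (𝓝 c) := by simpa using h0.add_const c
  refine h1.congr' ?_
  have hpos : ∀ᶠ r : ℝ in 𝓝[<] 1, 0 < r := nhdsWithin_le_nhds (lt_mem_nhds one_pos)
  filter_upwards [hpos, self_mem_nhdsWithin] with r hr0 hr1
  have hrb : (r : ℂ) ∈ ball (0 : ℂ) 1 := by
    rw [mem_ball_zero_iff, Complex.norm_real, Real.norm_of_nonneg hr0.le]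
    exact hr1
  have h2 : HasDerivAt (fun z : ℂ => h 1 + (z - 1) • c) c r := by
    simpa using (((hasDerivAt_id (r : ℂ)).sub_const 1).smul_const c).const_add (h 1)
  have h3 := (hh.differentiableAt isOpen_ball hrb).hasDerivAt.sub h2
  have h4 : deriv (fun z => h z - (h 1 + (z - 1) • c)) r = deriv h r - c := h3.deriv
  rw [h4, sub_add_cancel]

end RadialLimits

/-! ### Boundary functions and Fatou's theorem in the Hardy space. -/

section BoundaryFunctions

open Metric Filter MeasureTheory Set

theorem hardySpace_summable_sq {E : Type*} [NormedAddCommGroup E] (f : HardySpace E) :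
    Summable fun n => ‖f n‖ ^ 2 := by
  have := (lp.memℓp f).summable (by norm_num)
  simpa using this

theorem hardySpace_norm_sq {E : Type*} [NormedAddCommGroup E] (f : HardySpace E) :
    ‖f‖ ^ 2 = ∑' n, ‖f n‖ ^ 2 := by
  have := lp.norm_rpow_eq_tsum (p := 2) (by norm_num) f
  simpa using this

/-- By the arithmetic-geometric inequality, `‖aₙ‖ / (n + 1) ≤ ‖aₙ‖² + 1 / (n + 1)²`. Integrating
thus gains absolute convergence up to the boundary, which the series of `f` itself need not have. -/
theorem hardyPrimitive_summable_bound {E : Type*} [NormedAddCommGroup E] (f : HardySpace E) :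
    Summable fun n : ℕ => ‖f n‖ / (n + 1 : ℝ) := by
  have h1 : Summable fun n : ℕ => (1 : ℝ) / ((n : ℝ) + 1) ^ 2 := by
    have := (summable_nat_add_iff 1).2 (Real.summable_one_div_nat_pow.2 (one_lt_two))
    simpa using this
  refine Summable.of_nonneg_of_le (fun n => by positivity) (fun n => ?_)
    ((hardySpace_summable_sq f).add h1)
  have h2 : (1 : ℝ) / ((n : ℝ) + 1) ^ 2 = (1 / ((n : ℝ) + 1)) ^ 2 := by rw [div_pow, one_pow]
  rw [h2, div_eq_mul_one_div]
  nlinarith [sq_nonneg (‖f n‖ - 1 / ((n : ℝ) + 1)), sq_nonneg ‖f n‖,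
    sq_nonneg (1 / ((n : ℝ) + 1))]

variable {E : Type*} [NormedAddCommGroup E] [InnerProductSpace ℂ E]

/-- The holomorphic primitive `∑ aₙ zⁿ⁺¹ / (n + 1)` of a function in the Hardy space. -/
noncomputable def hardyPrimitive (f : HardySpace E) (z : ℂ) : E :=
  ∑' n : ℕ, (z ^ (n + 1) / (n + 1 : ℂ)) • f n

theorem norm_hardyPrimitive_term_le (f : HardySpace E) (n : ℕ) {z : ℂ} (hz : ‖z‖ ≤ 1) :
    ‖(z ^ (n + 1) / (n + 1 : ℂ)) • f n‖ ≤ ‖f n‖ / (n + 1 : ℝ) := by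
  have h : ‖((n : ℂ) + 1)‖ = (n : ℝ) + 1 := by
    have : ((n : ℂ) + 1) = ((n + 1 : ℕ) : ℂ) := by push_cast; rfl
    rw [this, Complex.norm_natCast]
    push_cast
    rfl
  rw [norm_smul, norm_div, norm_pow, h, div_mul_eq_mul_div]
  gcongr
  exact mul_le_of_le_one_left (norm_nonneg _) (pow_le_one₀ (norm_nonneg _) hz)

theorem hardyPrimitive_hasSum [CompleteSpace E] (f : HardySpace E) {z : ℂ} (hz : ‖z‖ ≤ 1) :
    HasSum (fun n : ℕ => (z ^ (n + 1) / (n + 1 : ℂ)) • f n) (hardyPrimitive f z) :=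
  (Summable.of_norm_bounded (hardyPrimitive_summable_bound f)
    fun n => norm_hardyPrimitive_term_le f n hz).hasSum

theorem hardyPrimitive_hasDerivAt [CompleteSpace E] (f : HardySpace E) {z : ℂ} (hz : ‖z‖ < 1) :
    HasDerivAt (hardyPrimitive f) (hardyEval f z) z := by
  obtain ⟨ρ, hρ, hρ1⟩ := exists_between hz
  have hρ0 : 0 < ρ := (norm_nonneg z).trans_lt hρ
  refine hasDerivAt_tsum_of_isPreconnected (u := fun n : ℕ => ρ ^ n * ‖f‖) (t := ball (0 : ℂ) ρ)
    (g := fun (n : ℕ) z => (z ^ (n + 1) / (n + 1 : ℂ)) • f n) (g' := fun n z => z ^ n • f n)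
    (y₀ := 0)
    ((summable_geometric_of_lt_one hρ0.le hρ1).mul_right _) isOpen_ball
    (convex_ball _ _).isPreconnected (fun n y _ => ?_) (fun n y hy => ?_) (by simpa using hρ0) ?_
    (by simpa using hρ)
  · have hn : (n + 1 : ℂ) ≠ 0 := Nat.cast_add_one_ne_zero n
    have h := ((hasDerivAt_pow (n + 1) y).div_const (n + 1 : ℂ)).smul_const (f n)
    simpa [hn, mul_div_assoc, mul_div_cancel_left₀] using h
  · rw [norm_smul, norm_pow]
    have hy : ‖y‖ < ρ := by simpa using hy
    gcongr
    exact lp.norm_apply_le_norm two_ne_zero f n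
  · simp

theorem hardyPrimitive_diffContOnCl [CompleteSpace E] (f : HardySpace E) :
    DiffContOnCl ℂ (hardyPrimitive f) (ball 0 1) where
  differentiableOn z hz :=
    (hardyPrimitive_hasDerivAt f (by simpa using hz)).differentiableAt.differentiableWithinAt
  continuousOn := by
    rw [closure_ball 0 one_ne_zero]
    refine continuousOn_tsum (fun n => ?_) (hardyPrimitive_summable_bound f)
      fun n z hz => norm_hardyPrimitive_term_le f n (by simpa using hz)
    fun_prop

/-- Radial limits from the differentiability of the primitive along the circle. -/
theorem tendsto_hardyEval_radial [CompleteSpace E] (f : HardySpace E) {θ : ℝ} {c : E}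
    (hd : HasDerivAt (fun t : ℝ => hardyPrimitive f (Complex.exp (t * Complex.I)))
      (Complex.I • c) θ) :
    Tendsto (fun r : ℝ => hardyEval f (r * Complex.exp (θ * Complex.I))) (𝓝[<] 1)
      (𝓝 (Complex.exp (-(θ * Complex.I)) • c)) := by
  set w := Complex.exp (θ * Complex.I) with hw
  have hwn : ‖w‖ = 1 := Complex.norm_exp_ofReal_mul_I θ
  have hk : DiffContOnCl ℂ (fun z => hardyPrimitive f (w * z)) (ball 0 1) := by
    refine (hardyPrimitive_diffContOnCl f).comp (g := fun z => w * z)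
      (Differentiable.diffContOnCl (by fun_prop)) fun z hz => ?_
    simpa [hwn] using hz
  have hd' : HasDerivAt (fun t : ℝ => hardyPrimitive f (w * Complex.exp (t * Complex.I)))
      (Complex.I • c) 0 := by
    have h1 := HasDerivAt.comp_const_add θ 0 (by simpa using hd)
    refine h1.congr_of_eventuallyEq (Eventually.of_forall fun t => ?_)
    simp only [hw]
    rw [← Complex.exp_add]
    push_cast
    ring_nf
  have h1 := (tendsto_deriv_radial hk hd').const_smul (Complex.exp (-(θ * Complex.I)))
  refine h1.congr' ?_
  have hpos : ∀ᶠ r : ℝ in 𝓝[<] 1, 0 < r := nhdsWithin_le_nhds (lt_mem_nhds one_pos)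
  filter_upwards [hpos, self_mem_nhdsWithin] with r hr0 hr1
  have hrn : ‖w * (r : ℂ)‖ < 1 := by
    rw [norm_mul, hwn, one_mul, Complex.norm_real, Real.norm_of_nonneg hr0.le]
    exact hr1
  have h2 : HasDerivAt (fun z : ℂ => w * z) w r := by simpa using (hasDerivAt_id (r : ℂ)).const_mul w
  have h3 := (hardyPrimitive_hasDerivAt f hrn).scomp (r : ℂ) h2
  have h4 : deriv (fun z => hardyPrimitive f (w * z)) r = w • hardyEval f (w * r) := h3.deriv
  rw [h4, smul_smul, hw, ← Complex.exp_add, neg_add_cancel, Complex.exp_zero, one_smul, mul_comm]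

theorem memLp_exp_smul (a : ℝ) (n : ℕ) (x : E) :
    MemLp (fun t : ℝ => ((√(2 * Real.pi) : ℂ)⁻¹ * Complex.exp ((n + 1) * Complex.I * t)) • x) 2
      (volume.restrict (Ioc a (a + 2 * Real.pi))) := by
  refine MemLp.of_bound (Continuous.aestronglyMeasurable (by fun_prop))
    ((√(2 * Real.pi))⁻¹ * ‖x‖) (Eventually.of_forall fun t => le_of_eq ?_)
  have : ((n : ℂ) + 1) * Complex.I * t = ((n + 1) * t : ℝ) * Complex.I := by
    push_cast; ring
  rw [this, norm_smul, norm_mul, Complex.norm_exp_ofReal_mul_I, norm_inv, Complex.norm_real,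
    Real.norm_of_nonneg (by positivity), mul_one]

/-- The embedding `x ↦ (2π)^{-1/2} e^{i(n+1)t} x` of `E` into `L²` of an interval of
length `2π`. -/
noncomputable def fourierEmbedding (a : ℝ) (n : ℕ) :
    E →ₗ[ℂ] Lp E 2 (volume.restrict (Ioc a (a + 2 * Real.pi))) :=
  { toFun := fun x => (memLp_exp_smul a n x).toLp _
    map_add' := fun x y => by
      rw [← MemLp.toLp_add]
      congr 1
      ext t
      simp
    map_smul' := fun c x => by
      rw [RingHom.id_apply, ← MemLp.toLp_const_smul]
      congr 1
      ext t
      simp [smul_comm c] }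

theorem coeFn_fourierEmbedding (a : ℝ) (n : ℕ) (x : E) :
    fourierEmbedding a n x =ᵐ[volume.restrict (Ioc a (a + 2 * Real.pi))]
      fun t : ℝ => ((√(2 * Real.pi) : ℂ)⁻¹ * Complex.exp ((n + 1) * Complex.I * t)) • x :=
  (memLp_exp_smul a n x).coeFn_toLp

theorem integral_conj_exp_mul_exp (a : ℝ) (m n : ℕ) :
    ∫ t in Ioc a (a + 2 * Real.pi), (starRingEnd ℂ) (Complex.exp ((m + 1) * Complex.I * t)) *
      Complex.exp ((n + 1) * Complex.I * t) = if m = n then (2 * Real.pi : ℂ) else 0 := by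
  have h1 : ∀ t : ℝ, (starRingEnd ℂ) (Complex.exp ((m + 1) * Complex.I * t)) *
      Complex.exp ((n + 1) * Complex.I * t) = Complex.exp (((n : ℂ) - m) * Complex.I * t) := by
    intro t
    rw [← Complex.exp_conj, ← Complex.exp_add]
    congr 1
    simp
    ring
  simp only [h1]
  rw [← intervalIntegral.integral_of_le (by linarith [Real.two_pi_pos])]
  split_ifs with h
  · simp [h]
  · have hc : ((n : ℂ) - m) * Complex.I ≠ 0 := by
      refine mul_ne_zero (sub_ne_zero.2 fun h2 => h ?_) Complex.I_ne_zero
      exact_mod_cast h2.symm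
    rw [integral_exp_mul_complex hc]
    have h2 : ((n : ℂ) - m) * Complex.I * (a + 2 * Real.pi : ℝ) = ((n : ℂ) - m) * Complex.I * a +
        ((n - m : ℤ) : ℂ) * (2 * Real.pi * Complex.I) := by push_cast; ring
    rw [h2, Complex.exp_add, Complex.exp_int_mul_two_pi_mul_I]
    simp

theorem inner_fourierEmbedding (a : ℝ) (m n : ℕ) (x y : E) :
    inner ℂ (fourierEmbedding a m x) (fourierEmbedding a n y) =
      if m = n then inner ℂ x y else 0 := by
  have hpi : (√(2 * Real.pi) : ℂ) ≠ 0 := by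
    exact_mod_cast (Real.sqrt_pos.2 Real.two_pi_pos).ne'
  have hpi2 : (√(2 * Real.pi) : ℂ) * √(2 * Real.pi) = 2 * Real.pi := by
    exact_mod_cast Real.mul_self_sqrt Real.two_pi_pos.le
  rw [L2.inner_def]
  have h1 : ∫ t in Ioc a (a + 2 * Real.pi), inner ℂ (fourierEmbedding a m x t)
      (fourierEmbedding a n y t) = ∫ t in Ioc a (a + 2 * Real.pi),
        ((starRingEnd ℂ) (Complex.exp ((m + 1) * Complex.I * t)) *
      Complex.exp ((n + 1) * Complex.I * t)) *
        ((√(2 * Real.pi) : ℂ)⁻¹ * (√(2 * Real.pi) : ℂ)⁻¹ * inner ℂ x y) := by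
    refine integral_congr_ae ?_
    filter_upwards [coeFn_fourierEmbedding a m x, coeFn_fourierEmbedding a n y] with t h1 h2
    rw [h1, h2, inner_smul_left, inner_smul_right, map_mul, map_inv₀, Complex.conj_ofReal]
    ring
  rw [h1, integral_mul_const, integral_conj_exp_mul_exp]
  split_ifs
  · rw [← hpi2]
    field_simp
  · simp

theorem norm_fourierEmbedding (a : ℝ) (n : ℕ) (x : E) : ‖fourierEmbedding a n x‖ = ‖x‖ := by
  have h := inner_fourierEmbedding a n n x x
  rw [if_pos rfl, inner_self_eq_norm_sq_to_K, inner_self_eq_norm_sq_to_K] at h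
  have h4 : ‖fourierEmbedding a n x‖ ^ 2 = ‖x‖ ^ 2 := by exact_mod_cast h
  exact (pow_left_inj₀ (norm_nonneg _) (norm_nonneg _) two_ne_zero).1 h4

theorem orthogonalFamily_fourierEmbedding (a : ℝ) :
    OrthogonalFamily ℂ (fun _ : ℕ => E)
      (fun n => (⟨fourierEmbedding a n, norm_fourierEmbedding a n⟩ : E →ₗᵢ[ℂ]
        Lp E 2 (volume.restrict (Ioc a (a + 2 * Real.pi))))) := by
  intro m n hmn x y
  exact (inner_fourierEmbedding a m n x y).trans (if_neg hmn)

/-- A function in the Hardy space has a square integrable boundary function (here multiplied by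
`e^{it}`), which is the derivative of the boundary values of the primitive. -/
theorem exists_boundary_function [CompleteSpace E] (f : HardySpace E) (a : ℝ) :
    ∃ g : ℝ → E, MemLp g 2 (volume.restrict (Ioc a (a + 2 * Real.pi))) ∧
      ∫ t in Ioc a (a + 2 * Real.pi), ‖g t‖ ^ 2 = 2 * Real.pi * ‖f‖ ^ 2 ∧
      ∀ θ ∈ Icc a (a + 2 * Real.pi), hardyPrimitive f (Complex.exp (θ * Complex.I)) =
        hardyPrimitive f (Complex.exp (a * Complex.I)) + Complex.I • ∫ t in a..θ, g t := by
  have hpi : (√(2 * Real.pi) : ℂ) ≠ 0 := by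
    exact_mod_cast (Real.sqrt_pos.2 Real.two_pi_pos).ne'
  set L := (orthogonalFamily_fourierEmbedding (E := E) a).linearIsometry with hL
  -- `F` plays the role of `e^{it} f(e^{it})`: the factor `√(2π)` undoes the normalization of
  -- `fourierEmbedding`, and the exponent `n + 1` there matches the angular derivative of `z ^ (n +
  -- 1) / (n + 1)`.
  set F : Lp E 2 (volume.restrict (Ioc a (a + 2 * Real.pi))) := (√(2 * Real.pi) : ℂ) • L f with hF
  have hnF : ‖F‖ ^ 2 = 2 * Real.pi * ‖f‖ ^ 2 := by
    rw [hF, norm_smul, L.norm_map, mul_pow, Complex.norm_real,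
      Real.norm_of_nonneg (by positivity), Real.sq_sqrt (by positivity)]
  have hsumF : HasSum (fun n => (√(2 * Real.pi) : ℂ) • fourierEmbedding a n (f n)) F :=
    ((orthogonalFamily_fourierEmbedding a).hasSum_linearIsometry f).const_smul _
  refine ⟨F, Lp.memLp F, ?_, fun θ hθ => ?_⟩
  · rw [← hnF]
    have h1 : inner ℂ F F = ((∫ t in Ioc a (a + 2 * Real.pi), ‖F t‖ ^ 2 : ℝ) : ℂ) := by
      rw [L2.inner_def, ← integral_complex_ofReal]
      congr 1
      ext t
      rw [inner_self_eq_norm_sq_to_K]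
      push_cast
      rfl
    have h2 : inner ℂ F F = ((‖F‖ ^ 2 : ℝ) : ℂ) := by
      rw [inner_self_eq_norm_sq_to_K]
      push_cast
      rfl
    exact Complex.ofReal_injective (h1.symm.trans h2)
  -- Tested against `c`, the integral over `(a, θ]` is the `L²` inner product with an indicator
  -- function. It is therefore continuous on `L²`, and the series of `F` may be integrated term by
  -- term.
  · refine ext_inner_left ℂ fun c => ?_
    have hθn : ∀ t : ℝ, ‖Complex.exp (t * Complex.I)‖ ≤ 1 :=
      fun t => (Complex.norm_exp_ofReal_mul_I t).le
    have hms : (volume.restrict (Ioc a (a + 2 * Real.pi))) (Ioc a θ) ≠ ⊤ := measure_ne_top _ _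
    have hset : ∀ G : ℝ → E, ∫ t in Ioc a θ, G t ∂(volume.restrict (Ioc a (a + 2 * Real.pi))) =
        ∫ t in a..θ, G t := by
      intro G
      rw [Measure.restrict_restrict measurableSet_Ioc, Ioc_inter_Ioc, max_self, min_eq_left hθ.2,
        intervalIntegral.integral_of_le hθ.1]
    have hinner : ∀ G : Lp E 2 (volume.restrict (Ioc a (a + 2 * Real.pi))),
        inner ℂ (indicatorConstLp 2 measurableSet_Ioc hms c) G =
          inner ℂ c (∫ t in a..θ, G t) := by
      intro G
      rw [L2.inner_indicatorConstLp_eq_inner_setIntegral, hset]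
    have hterm : ∀ n : ℕ, ∫ t in a..θ,
        ((√(2 * Real.pi) : ℂ) • fourierEmbedding a n (f n) :
          Lp E 2 (volume.restrict (Ioc a (a + 2 * Real.pi)))) t =
        ((Complex.exp ((n + 1) * Complex.I * θ) - Complex.exp ((n + 1) * Complex.I * a)) /
          ((n + 1) * Complex.I)) • f n := by
      intro n
      have hn : ((n : ℂ) + 1) * Complex.I ≠ 0 :=
        mul_ne_zero (Nat.cast_add_one_ne_zero n) Complex.I_ne_zero
      rw [← integral_exp_mul_complex hn, ← intervalIntegral.integral_smul_const, ← hset, ← hset]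
      refine integral_congr_ae (ae_restrict_of_ae ?_)
      filter_upwards [coeFn_fourierEmbedding a n (f n),
        Lp.coeFn_smul (√(2 * Real.pi) : ℂ) (fourierEmbedding a n (f n))] with t h1 h2
      rw [h2, Pi.smul_apply, h1, smul_smul, ← mul_assoc, mul_inv_cancel₀ hpi, one_mul]
    have hs1 : HasSum (fun n : ℕ => inner ℂ c
        (((Complex.exp ((n + 1) * Complex.I * θ) - Complex.exp ((n + 1) * Complex.I * a)) /
          ((n + 1) * Complex.I)) • f n)) (inner ℂ c (∫ t in a..θ, F t)) := by
      rw [← hinner F]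
      refine (((innerSL ℂ) (indicatorConstLp 2 measurableSet_Ioc hms c)).hasSum hsumF).congr_fun ?_
      intro n
      simp only [innerSL_apply_apply]
      rw [hinner, hterm]
    have hs2 : HasSum (fun n : ℕ => inner ℂ c
        (Complex.I • (((Complex.exp ((n + 1) * Complex.I * θ) -
          Complex.exp ((n + 1) * Complex.I * a)) / ((n + 1) * Complex.I)) • f n)))
        (inner ℂ c (hardyPrimitive f (Complex.exp (θ * Complex.I)) -
          hardyPrimitive f (Complex.exp (a * Complex.I)))) := by
      refine ((innerSL ℂ c).hasSum ((hardyPrimitive_hasSum f (hθn θ)).sub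
        (hardyPrimitive_hasSum f (hθn a)))).congr_fun fun n => ?_
      have hn : ((n : ℂ) + 1) ≠ 0 := Nat.cast_add_one_ne_zero n
      have he : ∀ t : ℝ, Complex.exp (t * Complex.I) ^ (n + 1) =
          Complex.exp ((n + 1) * Complex.I * t) := by
        intro t
        rw [← Complex.exp_nat_mul]
        push_cast
        ring_nf
      simp only [innerSL_apply_apply]
      rw [← sub_smul, he, he, smul_smul]
      congr 2
      field_simp
    have hs3 : HasSum (fun n : ℕ => inner ℂ c
        (Complex.I • (((Complex.exp ((n + 1) * Complex.I * θ) -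
          Complex.exp ((n + 1) * Complex.I * a)) / ((n + 1) * Complex.I)) • f n)))
        (inner ℂ c (Complex.I • ∫ t in a..θ, F t)) := by
      simp only [inner_smul_right] at hs1 ⊢
      exact hs1.mul_left Complex.I
    have := hs2.unique hs3
    rw [inner_add_right, ← this, inner_sub_right]
    ring

/-- **Fatou's theorem** for the vector-valued Hardy space, on an interval of length `2π`: radial
limits exist almost everywhere, and the norm is the `L²` norm of the boundary function. -/
theorem exists_ae_tendsto_hardyEval [CompleteSpace E] (f : HardySpace E) (a : ℝ) :
    ∃ g : ℝ → E, MemLp g 2 (volume.restrict (Ioc a (a + 2 * Real.pi))) ∧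
      ∫ t in Ioc a (a + 2 * Real.pi), ‖g t‖ ^ 2 = 2 * Real.pi * ‖f‖ ^ 2 ∧
      ∀ᵐ (θ : ℝ) ∂(volume.restrict (Ioc a (a + 2 * Real.pi))),
        Tendsto (fun r : ℝ => hardyEval f (r * Complex.exp (θ * Complex.I))) (𝓝[<] 1)
          (𝓝 (Complex.exp (-(θ * Complex.I)) • g θ)) := by
  obtain ⟨g, hg, hgn, hgi⟩ := exists_boundary_function f a
  refine ⟨g, hg, hgn, ?_⟩
  have hab : a ≤ a + 2 * Real.pi := by linarith [Real.two_pi_pos]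
  have hgint : IntervalIntegrable g volume a (a + 2 * Real.pi) := by
    rw [intervalIntegrable_iff_integrableOn_Ioc_of_le hab]
    exact hg.integrable one_le_two
  rw [ae_restrict_iff' measurableSet_Ioc]
  -- The integral formula for the primitive is known only on the closed interval, so the right
  -- endpoint is discarded to have it in a neighbourhood of `θ`.
  have hne : ∀ᵐ θ : ℝ, θ ≠ a + 2 * Real.pi := by simp [ae_iff, measure_singleton]
  filter_upwards [hgint.ae_hasDerivAt_integral, hne] with θ hθ hθne hmem
  have hθm : θ ∈ Ioo a (a + 2 * Real.pi) := ⟨hmem.1, lt_of_le_of_ne hmem.2 hθne⟩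
  rw [uIcc_of_le hab] at hθ
  have h1 := ((hθ (Ioo_subset_Icc_self hθm) a (left_mem_Icc.2 hab)).const_smul
    Complex.I).const_add (hardyPrimitive f (Complex.exp (a * Complex.I)))
  refine tendsto_hardyEval_radial f (h1.congr_of_eventuallyEq ?_)
  filter_upwards [Ioo_mem_nhds hθm.1 hθm.2] with t ht
  exact hgi t (Ioo_subset_Icc_self ht)

/-- Countably many translates of an interval of length `2π` tile the line. -/
theorem ae_of_forall_restrict_Ioc {p : ℝ → Prop}
    (h : ∀ a : ℝ, ∀ᵐ (θ : ℝ) ∂(volume.restrict (Ioc a (a + 2 * Real.pi))), p θ) : ∀ᵐ θ : ℝ, p θ := by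
  have h1 : ∀ᵐ (θ : ℝ) ∂(volume.restrict (⋃ n : ℤ, Ioc (n • (2 * Real.pi))
      (n • (2 * Real.pi) + 2 * Real.pi))), p θ := by
    rw [ae_restrict_iUnion_iff]
    exact fun n => h _
  have h2 : ⋃ n : ℤ, Ioc (n • (2 * Real.pi)) (n • (2 * Real.pi) + 2 * Real.pi) = univ := by
    have := iUnion_Ioc_zsmul Real.two_pi_pos
    simpa [add_smul] using this
  rwa [h2, Measure.restrict_univ] at h1

/-- A function in the Hardy space with `‖f(z)‖ ≤ ‖f‖` on the disc has radial limits of norm `‖f‖`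
almost everywhere. -/
theorem ae_exists_tendsto_hardyEval_norm_eq [CompleteSpace E] (f : HardySpace E)
    (hf : ∀ z ∈ ball (0 : ℂ) 1, ‖hardyEval f z‖ ≤ ‖f‖) :
    ∀ᵐ θ : ℝ, ∃ y : E, ‖y‖ = ‖f‖ ∧
      Tendsto (fun r : ℝ => hardyEval f (r * Complex.exp (θ * Complex.I))) (𝓝[<] 1) (𝓝 y) := by
  refine ae_of_forall_restrict_Ioc fun a => ?_
  obtain ⟨g, hg, hgn, hgt⟩ := exists_ae_tendsto_hardyEval f a
  have hexp : ∀ (θ : ℝ) (x : E), ‖Complex.exp (-(θ * Complex.I)) • x‖ = ‖x‖ := by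
    intro θ x
    have : -(θ * Complex.I) = ((-θ : ℝ) : ℂ) * Complex.I := by push_cast; ring
    rw [this, norm_smul, Complex.norm_exp_ofReal_mul_I, one_mul]
  have hle : ∀ᵐ (θ : ℝ) ∂(volume.restrict (Ioc a (a + 2 * Real.pi))), ‖g θ‖ ≤ ‖f‖ := by
    filter_upwards [hgt] with θ hθ
    rw [← hexp θ]
    refine le_of_tendsto hθ.norm ?_
    have hpos : ∀ᶠ r : ℝ in 𝓝[<] 1, 0 < r := nhdsWithin_le_nhds (lt_mem_nhds one_pos)
    filter_upwards [hpos, self_mem_nhdsWithin] with r hr0 hr1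
    refine hf _ ?_
    rw [mem_ball_zero_iff, norm_mul, Complex.norm_exp_ofReal_mul_I, mul_one, Complex.norm_real,
      Real.norm_of_nonneg hr0.le]
    exact hr1
  have hgsq : Integrable (fun t => ‖g t‖ ^ 2) (volume.restrict (Ioc a (a + 2 * Real.pi))) :=
    (memLp_two_iff_integrable_sq_norm hg.1).1 hg
  -- The integrand is nonnegative almost everywhere by `hle`, so its zero integral makes it vanish
  -- almost everywhere.
  have hsub : ∫ t in Ioc a (a + 2 * Real.pi), (‖f‖ ^ 2 - ‖g t‖ ^ 2) = 0 := by
    rw [integral_sub (integrable_const _) hgsq, hgn]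
    simp [Real.two_pi_pos.le]
  rw [integral_eq_zero_iff_of_nonneg_ae] at hsub
  · filter_upwards [hgt, hsub] with θ h1 h2
    refine ⟨_, ?_, h1⟩
    rw [hexp]
    have h3 : ‖g θ‖ ^ 2 = ‖f‖ ^ 2 := by
      simp only [Pi.zero_apply] at h2
      linarith
    exact (pow_left_inj₀ (norm_nonneg _) (norm_nonneg _) two_ne_zero).1 h3
  · filter_upwards [hle] with θ hθ
    simp only [Pi.zero_apply, sub_nonneg]
    gcongr
  · exact (integrable_const _).sub hgsq

end BoundaryFunctions

/-! ### Reproducing kernels, symbols and inner functions. -/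

section HardyOperators

open Metric Filter

variable {E : Type*} [NormedAddCommGroup E] [InnerProductSpace ℂ E]

theorem hardyEval_hasSum [CompleteSpace E] (f : HardySpace E) {z : ℂ}
    (hz : z ∈ ball (0 : ℂ) 1) : HasSum (fun n : ℕ => z ^ n • f n) (hardyEval f z) := by
  have hz1 : ‖z‖ < 1 := by simpa using hz
  refine (Summable.of_norm_bounded
    ((summable_geometric_of_lt_one (norm_nonneg z) hz1).mul_right ‖f‖) fun n => ?_).hasSum
  rw [norm_smul, norm_pow]
  gcongr
  exact lp.norm_apply_le_norm two_ne_zero f n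

theorem hardyEval_single (n : ℕ) (x : E) (z : ℂ) :
    hardyEval (lp.single 2 n x : HardySpace E) z = z ^ n • x := by
  rw [hardyEval, tsum_eq_single n]
  · rw [lp.single_apply_self]
  · intro m hm
    rw [lp.single_apply_ne _ _ _ hm, smul_zero]

theorem memℓp_hardyKernel {z : ℂ} (hz : z ∈ ball (0 : ℂ) 1) (x : E) :
    Memℓp (fun n : ℕ => (starRingEnd ℂ z) ^ n • x) 2 := by
  have hz1 : ‖z‖ < 1 := by simpa using hz
  have h2 : ‖z‖ ^ 2 < 1 := pow_lt_one₀ (norm_nonneg _) hz1 two_ne_zero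
  refine memℓp_gen ?_
  refine ((summable_geometric_of_lt_one (by positivity) h2).mul_right (‖x‖ ^ 2)).congr fun n => ?_
  simp [norm_smul, mul_pow]
  left
  ring

/-- The Szegő kernel `x / (1 - z̄ w)` at the point `z` and in the direction `x`. -/
noncomputable def hardyKernel {z : ℂ} (hz : z ∈ ball (0 : ℂ) 1) (x : E) : HardySpace E :=
  ⟨fun n : ℕ => (starRingEnd ℂ z) ^ n • x, memℓp_hardyKernel hz x⟩

theorem hardyKernel_apply {z : ℂ} (hz : z ∈ ball (0 : ℂ) 1) (x : E) (n : ℕ) :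
    hardyKernel hz x n = (starRingEnd ℂ z) ^ n • x := rfl

/-- Reproducing property: pairing with the coefficients `z̄ⁿ x` sums the power series of `f` at `z`.
-/
theorem inner_hardyKernel [CompleteSpace E] {z : ℂ} (hz : z ∈ ball (0 : ℂ) 1) (x : E)
    (f : HardySpace E) : inner ℂ (hardyKernel hz x) f = inner ℂ x (hardyEval f z) := by
  refine (lp.hasSum_inner (hardyKernel hz x) f).unique ?_
  refine ((innerSL ℂ x).hasSum (hardyEval_hasSum f hz)).congr_fun fun n => ?_
  simp only [innerSL_apply_apply]
  rw [hardyKernel_apply, inner_smul_left, inner_smul_right, map_pow, Complex.conj_conj]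

theorem norm_hardyKernel_sq {z : ℂ} (hz : z ∈ ball (0 : ℂ) 1) (x : E) :
    ‖hardyKernel hz x‖ ^ 2 = (1 - ‖z‖ ^ 2)⁻¹ * ‖x‖ ^ 2 := by
  have hz1 : ‖z‖ < 1 := by simpa using hz
  have h2 : ‖z‖ ^ 2 < 1 := pow_lt_one₀ (norm_nonneg _) hz1 two_ne_zero
  rw [hardySpace_norm_sq]
  refine HasSum.tsum_eq ?_
  refine ((hasSum_geometric_of_lt_one (by positivity) h2).mul_right (‖x‖ ^ 2)).congr_fun fun n => ?_
  rw [hardyKernel_apply, norm_smul, norm_pow, Complex.norm_conj, mul_pow, ← pow_mul, ← pow_mul,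
    mul_comm n]

/-- Cauchy–Schwarz against the kernel at `z` in the direction of the value of `f` there. -/
theorem norm_hardyEval_sq_le [CompleteSpace E] (f : HardySpace E) {z : ℂ}
    (hz : z ∈ ball (0 : ℂ) 1) : (1 - ‖z‖ ^ 2) * ‖hardyEval f z‖ ^ 2 ≤ ‖f‖ ^ 2 := by
  have hz1 : ‖z‖ < 1 := by simpa using hz
  have h2 : 0 < 1 - ‖z‖ ^ 2 := sub_pos.2 (pow_lt_one₀ (norm_nonneg _) hz1 two_ne_zero)
  have h3 := norm_inner_le_norm (𝕜 := ℂ) (hardyKernel hz (hardyEval f z)) f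
  rw [inner_hardyKernel, inner_self_eq_norm_sq_to_K] at h3
  have h4 : ‖hardyEval f z‖ ^ 2 ≤ ‖hardyKernel hz (hardyEval f z)‖ * ‖f‖ := by simpa using h3
  have h5 := pow_le_pow_left₀ (by positivity) h4 2
  rw [mul_pow, norm_hardyKernel_sq] at h5
  rcases (norm_nonneg (hardyEval f z)).eq_or_lt with h | h
  · rw [← h]; simp
  · have h6 : 0 < ‖hardyEval f z‖ ^ 2 := by positivity
    have h7 : ‖hardyEval f z‖ ^ 2 ≤ (1 - ‖z‖ ^ 2)⁻¹ * ‖f‖ ^ 2 := by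
      by_contra! hc
      nlinarith
    calc (1 - ‖z‖ ^ 2) * ‖hardyEval f z‖ ^ 2
        ≤ (1 - ‖z‖ ^ 2) * ((1 - ‖z‖ ^ 2)⁻¹ * ‖f‖ ^ 2) := by gcongr
      _ = ‖f‖ ^ 2 := by field_simp

theorem hardyEval_hardyKernel [CompleteSpace E] {z : ℂ} (hz : z ∈ ball (0 : ℂ) 1) (x : E) :
    hardyEval (hardyKernel hz x) z = ((1 - ‖z‖ ^ 2 : ℝ) : ℂ)⁻¹ • x := by
  have hz1 : ‖z‖ < 1 := by simpa using hz
  have h2 : ‖z‖ ^ 2 < 1 := pow_lt_one₀ (norm_nonneg _) hz1 two_ne_zero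
  refine (hardyEval_hasSum _ hz).unique ?_
  have h3 : ‖((‖z‖ ^ 2 : ℝ) : ℂ)‖ < 1 := by
    rwa [Complex.norm_real, Real.norm_of_nonneg (by positivity)]
  have h4 := (hasSum_geometric_of_norm_lt_one h3).smul_const x
  rw [← Complex.ofReal_one, ← Complex.ofReal_sub] at h4
  refine h4.congr_fun fun n => ?_
  rw [hardyKernel_apply, smul_smul, ← mul_pow, Complex.mul_conj, Complex.normSq_eq_norm_sq]

/-- Evaluation at a point of the disc as a bounded operator. -/
noncomputable def hardyEvalCLM [CompleteSpace E] {z : ℂ} (hz : z ∈ ball (0 : ℂ) 1) :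
    HardySpace E →L[ℂ] E :=
  LinearMap.mkContinuous
    { toFun := fun f => hardyEval f z
      map_add' := fun f g => by
        refine (hardyEval_hasSum (f + g) hz).unique ?_
        refine ((hardyEval_hasSum f hz).add (hardyEval_hasSum g hz)).congr_fun fun n => ?_
        simp
      map_smul' := fun c f => by
        refine (hardyEval_hasSum (c • f) hz).unique ?_
        refine ((hardyEval_hasSum f hz).const_smul c).congr_fun fun n => ?_
        simp [smul_comm c] }
    (√(1 - ‖z‖ ^ 2))⁻¹ fun f => by
      have hz1 : ‖z‖ < 1 := by simpa using hz
      have h2 : 0 < 1 - ‖z‖ ^ 2 := sub_pos.2 (pow_lt_one₀ (norm_nonneg _) hz1 two_ne_zero)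
      have h3 := Real.sqrt_le_sqrt (norm_hardyEval_sq_le f hz)
      rw [Real.sqrt_mul h2.le, Real.sqrt_sq (norm_nonneg _), Real.sqrt_sq (norm_nonneg _)] at h3
      rw [inv_mul_eq_div, le_div_iff₀ (Real.sqrt_pos.2 h2), mul_comm]
      exact h3

theorem hardyEvalCLM_apply [CompleteSpace E] {z : ℂ} (hz : z ∈ ball (0 : ℂ) 1)
    (f : HardySpace E) : hardyEvalCLM hz f = hardyEval f z := rfl

/-- The Taylor coefficients `x ↦ (T x)ₙ` of the symbol of an operator on the Hardy space. -/
noncomputable def hardyTaylorOp (T : HardySpace E →L[ℂ] HardySpace E) (n : ℕ) : E →L[ℂ] E :=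
  lp.evalCLM ℂ (fun _ : ℕ => E) 2 n ∘L T ∘L lp.singleContinuousLinearMap ℂ (fun _ : ℕ => E) 2 0

theorem hardyTaylorOp_apply (T : HardySpace E →L[ℂ] HardySpace E) (n : ℕ) (x : E) :
    hardyTaylorOp T n x = T (lp.single 2 0 x) n := rfl

theorem norm_hardyTaylorOp_le (T : HardySpace E →L[ℂ] HardySpace E) (n : ℕ) :
    ‖hardyTaylorOp T n‖ ≤ ‖T‖ := by
  refine ContinuousLinearMap.opNorm_le_bound _ (ContinuousLinearMap.opNorm_nonneg T) fun x => ?_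
  rw [hardyTaylorOp_apply]
  refine (lp.norm_apply_le_norm two_ne_zero (T (lp.single 2 0 x)) n).trans ?_
  refine (T.le_opNorm _).trans (le_of_eq ?_)
  rw [lp.norm_single (by norm_num)]

/-- The symbol `z ↦ (x ↦ (T x)(z))` of an operator on the Hardy space. -/
noncomputable def hardySymbol (T : HardySpace E →L[ℂ] HardySpace E) (z : ℂ) : E →L[ℂ] E :=
  ∑' n : ℕ, z ^ n • hardyTaylorOp T n

theorem norm_pow_smul_hardyTaylorOp_le (T : HardySpace E →L[ℂ] HardySpace E) (z : ℂ) (n : ℕ) :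
    ‖z ^ n • hardyTaylorOp T n‖ ≤ ‖z‖ ^ n * ‖T‖ := by
  rw [norm_smul, norm_pow]
  gcongr
  exact norm_hardyTaylorOp_le T n

theorem hardySymbol_hasSum [CompleteSpace E] (T : HardySpace E →L[ℂ] HardySpace E) {z : ℂ}
    (hz : z ∈ ball (0 : ℂ) 1) :
    HasSum (fun n : ℕ => z ^ n • hardyTaylorOp T n) (hardySymbol T z) := by
  have hz1 : ‖z‖ < 1 := by simpa using hz
  exact (Summable.of_norm_bounded
    ((summable_geometric_of_lt_one (norm_nonneg z) hz1).mul_right ‖T‖)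
    fun n => norm_pow_smul_hardyTaylorOp_le T z n).hasSum

theorem hardySymbol_apply [CompleteSpace E] (T : HardySpace E →L[ℂ] HardySpace E) {z : ℂ}
    (hz : z ∈ ball (0 : ℂ) 1) (x : E) :
    hardySymbol T z x = hardyEval (T (lp.single 2 0 x)) z := by
  refine HasSum.unique ?_ (hardyEval_hasSum _ hz)
  refine ((ContinuousLinearMap.apply ℂ E x).hasSum (hardySymbol_hasSum T hz)).congr_fun fun n => ?_
  simp [hardyTaylorOp_apply]

theorem hardySymbol_differentiableOn [CompleteSpace E] (T : HardySpace E →L[ℂ] HardySpace E) :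
    DifferentiableOn ℂ (hardySymbol T) (ball 0 1) := by
  intro z hz
  obtain ⟨ρ, hρ, hρ1⟩ := exists_between (show ‖z‖ < 1 by simpa using hz)
  have hρ0 : 0 < ρ := (norm_nonneg z).trans_lt hρ
  have h : DifferentiableOn ℂ (hardySymbol T) (ball 0 ρ) := by
    refine Complex.differentiableOn_tsum_of_summable_norm
      ((summable_geometric_of_lt_one hρ0.le hρ1).mul_right ‖T‖) (fun n => ?_) isOpen_ball
      fun n w hw => (norm_pow_smul_hardyTaylorOp_le T w n).trans ?_
    · fun_prop
    · have : ‖w‖ < ρ := by simpa using hw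
      gcongr
  exact (h.differentiableAt (isOpen_ball.mem_nhds (by simpa using hρ))).differentiableWithinAt

theorem single_eq_pow_mul_single [CompleteSpace E] {Z : HardySpace E →L[ℂ] HardySpace E}
    (hZ : IsMulOp (coordFun E) Z) (n : ℕ) (x : E) :
    (lp.single 2 n x : HardySpace E) = (Z ^ n) (lp.single 2 0 x) := by
  induction n with
  | zero => simp
  | succ n ih =>
    refine hardyEval_injective fun z hz => ?_
    rw [pow_succ', mul_apply_eq_comp, ← ih, hZ _ z hz, hardyEval_single, hardyEval_single]
    simp [coordFun, smul_smul, pow_succ', mul_comm]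

/-- An operator on the Hardy space which commutes with `M_z` is multiplication by its symbol. -/
theorem isMulOp_hardySymbol [CompleteSpace E] {Z T : HardySpace E →L[ℂ] HardySpace E}
    (hZ : IsMulOp (coordFun E) Z) (hTZ : T * Z = Z * T) : IsMulOp (hardySymbol T) T := by
  intro f z hz
  have hpow : ∀ (n : ℕ) (g : HardySpace E), hardyEval ((Z ^ n) g) z = z ^ n • hardyEval g z := by
    intro n g
    induction n with
    | zero => simp
    | succ n ih =>
      rw [pow_succ', mul_apply_eq_comp, hZ _ z hz, ih]
      simp [coordFun, smul_smul, pow_succ', mul_comm]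
  -- Both sides are continuous in `f`, so monomials suffice. These are powers of `Z` applied to
  -- constants; `T` passes through the powers, and its values on constants define the symbol.
  have hs := lp.hasSum_single (p := 2) (by norm_num) f
  have h1 := (hardyEvalCLM hz ∘L T).hasSum hs
  have h2 := (hardySymbol T z).hasSum (hardyEval_hasSum f hz)
  refine h1.unique (h2.congr_fun fun n => ?_)
  have hc : T * Z ^ n = Z ^ n * T := (show Commute T Z from hTZ).pow_right n
  rw [ContinuousLinearMap.comp_apply, hardyEvalCLM_apply, single_eq_pow_mul_single hZ,
    ← mul_apply_eq_comp, hc, mul_apply_eq_comp, hpow, map_smul, hardySymbol_apply T hz]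

/-- The symbol of a contractive multiplication operator is contractive. -/
theorem norm_hardySymbol_apply_le [CompleteSpace E] {T : HardySpace E →L[ℂ] HardySpace E}
    (hT : IsMulOp (hardySymbol T) T) (hn : ∀ f, ‖T f‖ = ‖f‖) {z : ℂ}
    (hz : z ∈ ball (0 : ℂ) 1) (x : E) : ‖hardySymbol T z x‖ ≤ ‖x‖ := by
  have hz1 : ‖z‖ < 1 := by simpa using hz
  have h2 : 0 < 1 - ‖z‖ ^ 2 := sub_pos.2 (pow_lt_one₀ (norm_nonneg _) hz1 two_ne_zero)
  -- The growth bound is attained by the kernel at `z`, so testing on it loses no constant.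
  have h3 := norm_hardyEval_sq_le (T (hardyKernel hz x)) hz
  rw [hT _ z hz, hn, norm_hardyKernel_sq, hardyEval_hardyKernel, map_smul, norm_smul, norm_inv,
    Complex.norm_real, Real.norm_of_nonneg h2.le, mul_pow] at h3
  have h4 : (1 - ‖z‖ ^ 2) * ((1 - ‖z‖ ^ 2)⁻¹ ^ 2 * ‖hardySymbol T z x‖ ^ 2) =
      (1 - ‖z‖ ^ 2)⁻¹ * ‖hardySymbol T z x‖ ^ 2 := by field_simp
  rw [h4] at h3
  have h5 := le_of_mul_le_mul_left h3 (inv_pos.2 h2)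
  exact (pow_le_pow_iff_left₀ (norm_nonneg _) (norm_nonneg _) two_ne_zero).1 h5

/-- Isometric strong limits extend from a set to its closure, for contractions. -/
theorem exists_tendsto_of_mem_closure [CompleteSpace E] {ι : Type*} {l : Filter ι} [l.NeBot]
    {A : ι → E →L[ℂ] E} (hA : ∀ᶠ i in l, ∀ x, ‖A i x‖ ≤ ‖x‖) {c : Set E}
    (hc : ∀ x ∈ c, ∃ y, ‖y‖ = ‖x‖ ∧ Tendsto (fun i => A i x) l (𝓝 y)) {x : E}
    (hx : x ∈ closure c) : ∃ y, ‖y‖ = ‖x‖ ∧ Tendsto (fun i => A i x) l (𝓝 y) := by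
  have happrox : ∀ ε > 0, ∃ x' ∈ c, ‖x - x'‖ < ε := by
    intro ε hε
    obtain ⟨x', h1, h2⟩ := Metric.mem_closure_iff.1 hx ε hε
    exact ⟨x', h1, by rwa [dist_eq_norm] at h2⟩
  have hcauchy : Cauchy (map (fun i => A i x) l) := by
    refine Metric.cauchy_iff.2 ⟨inferInstance, fun ε hε => ?_⟩
    obtain ⟨x', hx', hxx'⟩ := happrox (ε / 4) (by positivity)
    obtain ⟨y, -, hy⟩ := hc x' hx'
    refine ⟨ball y (ε / 2), ?_, fun u hu v hv => ?_⟩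
    · rw [mem_map]
      filter_upwards [hA, hy.eventually (ball_mem_nhds y (show 0 < ε / 4 by positivity))]
        with i h1 h2
      have h3 := h1 (x - x')
      rw [map_sub] at h3
      rw [Set.mem_preimage, mem_ball, dist_eq_norm]
      rw [dist_eq_norm] at h2
      have := norm_sub_le_norm_sub_add_norm_sub (A i x) (A i x') y
      linarith
    · have := dist_triangle_right u v y
      rw [mem_ball] at hu hv
      linarith
  obtain ⟨y, hy⟩ := CompleteSpace.complete hcauchy
  refine ⟨y, ?_, hy⟩
  refine eq_of_abs_sub_le_all fun ε hε => ?_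
  obtain ⟨x', hx', hxx'⟩ := happrox (ε / 2) (by positivity)
  obtain ⟨y', hy'n, hy'⟩ := hc x' hx'
  have h1 : ‖y - y'‖ ≤ ‖x - x'‖ := by
    refine le_of_tendsto (Tendsto.sub (show Tendsto (fun i => A i x) l (𝓝 y) from hy) hy').norm ?_
    filter_upwards [hA] with i hi
    rw [← map_sub]
    exact hi _
  have h2 := abs_norm_sub_norm_le y y'
  have h3 := abs_norm_sub_norm_le x x'
  rw [abs_le] at *
  constructor <;> linarith [h2.1, h2.2, h3.1, h3.2]

/-- The symbol of an isometric multiplication operator on the Hardy space is inner. -/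
theorem isInner_hardySymbol [CompleteSpace E] {T : HardySpace E →L[ℂ] HardySpace E}
    (hT : IsMulOp (hardySymbol T) T) (hn : ∀ f, ‖T f‖ = ‖f‖) : IsInner (hardySymbol T) := by
  refine ⟨⟨hardySymbol_differentiableOn T, 1, fun z hz => ?_⟩, fun M hM => ?_⟩
  · refine ContinuousLinearMap.opNorm_le_bound _ zero_le_one fun x => ?_
    rw [one_mul]
    exact norm_hardySymbol_apply_le hT hn hz x
  -- The countable set `c` has `M` in its closure and need not lie in `M`. The null sets of its
  -- points are united, and contractivity carries the limits to the closure.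
  obtain ⟨c, hc, hMc⟩ := hM
  have hball : ∀ θ : ℝ, ∀ᶠ r : ℝ in 𝓝[<] 1,
      (r : ℂ) * Complex.exp (θ * Complex.I) ∈ ball (0 : ℂ) 1 := by
    intro θ
    have hpos : ∀ᶠ r : ℝ in 𝓝[<] 1, 0 < r := nhdsWithin_le_nhds (lt_mem_nhds one_pos)
    filter_upwards [hpos, self_mem_nhdsWithin] with r hr0 hr1
    rw [mem_ball_zero_iff, norm_mul, Complex.norm_exp_ofReal_mul_I, mul_one, Complex.norm_real,
      Real.norm_of_nonneg hr0.le]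
    exact hr1
  have hae : ∀ᵐ θ : ℝ, ∀ x ∈ c, ∃ y : E, ‖y‖ = ‖x‖ ∧
      Tendsto (fun r : ℝ => hardySymbol T (r * Complex.exp (θ * Complex.I)) x) (𝓝[<] 1)
        (𝓝 y) := by
    rw [MeasureTheory.ae_ball_iff hc]
    intro x _
    have hxn : ‖T (lp.single 2 0 x)‖ = ‖x‖ := by rw [hn, lp.norm_single (by norm_num)]
    have := ae_exists_tendsto_hardyEval_norm_eq (T (lp.single 2 0 x)) fun z hz => by
      rw [← hardySymbol_apply T hz, hxn]
      exact norm_hardySymbol_apply_le hT hn hz x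
    filter_upwards [this] with θ ⟨y, hy, hlim⟩
    refine ⟨y, hy.trans hxn, hlim.congr' ?_⟩
    filter_upwards [hball θ] with r hr
    rw [hardySymbol_apply T hr]
  filter_upwards [hae] with θ hθ
  have hlim : ∀ x : M, ∃ y : E, ‖y‖ = ‖(x : E)‖ ∧
      Tendsto (fun r : ℝ => hardySymbol T (r * Complex.exp (θ * Complex.I)) x) (𝓝[<] 1)
        (𝓝 y) := fun x => exists_tendsto_of_mem_closure (by
      filter_upwards [hball θ] with r hr x using norm_hardySymbol_apply_le hT hn hr x)
      hθ (hMc x.2)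
  choose V hVn hV using hlim
  refine ⟨⟨⟨⟨V, fun x y => ?_⟩, fun a x => ?_⟩, hVn⟩, hV⟩
  · refine tendsto_nhds_unique (hV (x + y)) (((hV x).add (hV y)).congr fun r => ?_)
    simp
  · refine tendsto_nhds_unique (hV (a • x)) (((hV x).const_smul a).congr fun r => ?_)
    simp

end HardyOperators

/-! ### Isometries, reducing subspaces and the hyper-range. -/

section Isometries

variable {H : Type*} [NormedAddCommGroup H] [InnerProductSpace ℂ H]

theorem mem_hyperRange_iff {T : H →L[ℂ] H} {x : H} :
    x ∈ hyperRange T ↔ ∀ n : ℕ, ∃ y, (T ^ n) y = x := by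
  simp only [hyperRange, Submodule.mem_iInf, LinearMap.mem_range, ContinuousLinearMap.coe_coe]

theorem invariantFor_hyperRange_of_commute {T A : H →L[ℂ] H} (h : A * T = T * A) :
    InvariantFor (hyperRange T) A := by
  intro x hx
  rw [mem_hyperRange_iff] at hx ⊢
  intro n
  obtain ⟨y, rfl⟩ := hx n
  have hc : A * T ^ n = T ^ n * A := (show Commute A T from h).pow_right n
  exact ⟨A y, by rw [← mul_apply_eq_comp, ← hc, mul_apply_eq_comp]⟩

theorem InvariantFor.pow {M : Submodule ℂ H} {T : H →L[ℂ] H} (h : InvariantFor M T) (n : ℕ) :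
    InvariantFor M (T ^ n) := by
  induction n with
  | zero => intro x hx; simpa using hx
  | succ n ih => intro x hx; rw [pow_succ', mul_apply_eq_comp]; exact h _ (ih x hx)

theorem coe_restrictOp_apply {M : Submodule ℂ H} {T : H →L[ℂ] H} (h : InvariantFor M T) (x : M) :
    ((restrictOp M T h x : M) : H) = T x := rfl

theorem coe_restrictOp_pow_apply {M : Submodule ℂ H} {T : H →L[ℂ] H} (h : InvariantFor M T)
    (n : ℕ) (x : M) : (((restrictOp M T h ^ n) x : M) : H) = (T ^ n) x := by
  induction n with
  | zero => simp
  | succ n ih => rw [pow_succ', mul_apply_eq_comp, coe_restrictOp_apply, ih, pow_succ',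
      mul_apply_eq_comp]

variable [CompleteSpace H]

theorem InvariantFor.orthogonal_adjoint {M : Submodule ℂ H} {T : H →L[ℂ] H}
    (h : InvariantFor M T) : InvariantFor Mᗮ (adjoint T) := by
  intro x hx
  rw [Submodule.mem_orthogonal] at hx ⊢
  intro u hu
  rw [ContinuousLinearMap.adjoint_inner_right]
  exact hx _ (h u hu)

theorem InvariantFor.orthogonal_of_adjoint {M : Submodule ℂ H} {T : H →L[ℂ] H}
    (h : InvariantFor M (adjoint T)) : InvariantFor Mᗮ T := by
  simpa using h.orthogonal_adjoint

theorem Reduces.adjoint {M : Submodule ℂ H} [CompleteSpace M] {T : H →L[ℂ] H}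
    (h : Reduces M T) : InvariantFor M (adjoint T) := by
  have := h.2.orthogonal_adjoint
  rwa [Submodule.orthogonal_orthogonal] at this

theorem adjoint_restrictOp {M : Submodule ℂ H} [CompleteSpace M] {T : H →L[ℂ] H}
    (h : InvariantFor M T) (h' : InvariantFor M (adjoint T)) :
    adjoint (restrictOp M T h) = restrictOp M (adjoint T) h' := by
  refine ((ContinuousLinearMap.eq_adjoint_iff _ _).2 fun x y => ?_).symm
  rw [Submodule.coe_inner, Submodule.coe_inner, coe_restrictOp_apply, coe_restrictOp_apply,
    ContinuousLinearMap.adjoint_inner_left]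

theorem isIsometryOp_iff {T : H →L[ℂ] H} : IsIsometryOp T ↔ ∀ x, adjoint T (T x) = x := by
  constructor
  · intro h x
    simpa using congrArg (fun A : H →L[ℂ] H => A x) h
  · intro h
    ext x
    simpa using h x

theorem IsIsometryOp.inner_map {T : H →L[ℂ] H} (hT : IsIsometryOp T) (x y : H) :
    inner ℂ (T x) (T y) = inner ℂ x y := by
  rw [← ContinuousLinearMap.adjoint_inner_left, isIsometryOp_iff.1 hT]

theorem isIsometryOp_of_inner_map {T : H →L[ℂ] H}
    (hT : ∀ x y, inner ℂ (T x) (T y) = inner ℂ x y) : IsIsometryOp T := by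
  refine isIsometryOp_iff.2 fun x => ext_inner_left ℂ fun y => ?_
  rw [ContinuousLinearMap.adjoint_inner_right, hT]

theorem IsIsometryOp.pow {T : H →L[ℂ] H} (hT : IsIsometryOp T) (n : ℕ) : IsIsometryOp (T ^ n) := by
  refine isIsometryOp_of_inner_map fun x y => ?_
  induction n with
  | zero => simp
  | succ n ih => rw [pow_succ', mul_apply_eq_comp, mul_apply_eq_comp, hT.inner_map, ih]

theorem IsIsometryOp.mul {S T : H →L[ℂ] H} (hS : IsIsometryOp S) (hT : IsIsometryOp T) :
    IsIsometryOp (S * T) :=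
  isIsometryOp_of_inner_map fun x y => by
    rw [mul_apply_eq_comp, mul_apply_eq_comp, hS.inner_map, hT.inner_map]

theorem IsIsometryOp.norm_map {T : H →L[ℂ] H} (hT : IsIsometryOp T) (x : H) : ‖T x‖ = ‖x‖ := by
  simpa [dist_zero_right] using (hT.isometry_pow 1).dist_eq x 0

theorem IsIsometryOp.restrictOp {T : H →L[ℂ] H} (hT : IsIsometryOp T) {M : Submodule ℂ H}
    [CompleteSpace M] (h : InvariantFor M T) : IsIsometryOp (restrictOp M T h) :=
  isIsometryOp_of_inner_map fun x y => by
    rw [Submodule.coe_inner, Submodule.coe_inner, coe_restrictOp_apply, coe_restrictOp_apply,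
      hT.inner_map]

theorem restrictOp_mem_unitary {T : H →L[ℂ] H} (hT : IsIsometryOp T) {M : Submodule ℂ H}
    [CompleteSpace M] (h : InvariantFor M T) (h' : InvariantFor M (adjoint T))
    (hs : ∀ x ∈ M, T (adjoint T x) = x) : restrictOp M T h ∈ unitary (M →L[ℂ] M) := by
  rw [Unitary.mem_iff, ContinuousLinearMap.star_eq_adjoint]
  refine ⟨hT.restrictOp h, ?_⟩
  rw [adjoint_restrictOp h h']
  ext x
  exact hs x x.2

/-- If `x = T ^ (n + 1) y`, then `T* x = T ^ n y`. -/
theorem IsIsometryOp.invariantFor_hyperRange_adjoint {T : H →L[ℂ] H} (hT : IsIsometryOp T) :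
    InvariantFor (hyperRange T) (adjoint T) := by
  intro x hx
  rw [mem_hyperRange_iff] at hx ⊢
  intro n
  obtain ⟨y, rfl⟩ := hx (n + 1)
  exact ⟨y, by rw [pow_succ', mul_apply_eq_comp, isIsometryOp_iff.1 hT]⟩

theorem IsIsometryOp.apply_adjoint_of_mem_hyperRange {T : H →L[ℂ] H} (hT : IsIsometryOp T) {x : H}
    (hx : x ∈ hyperRange T) : T (adjoint T x) = x := by
  obtain ⟨y, rfl⟩ := mem_hyperRange_iff.1 hx 1
  rw [pow_one, isIsometryOp_iff.1 hT]

theorem IsIsometryOp.reduces_hyperRange {T : H →L[ℂ] H} (hT : IsIsometryOp T) :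
    Reduces (hyperRange T) T :=
  ⟨invariantFor_hyperRange_of_commute rfl,
    hT.invariantFor_hyperRange_adjoint.orthogonal_of_adjoint⟩

end Isometries

/-! ### The Wold decomposition and transport to the Hardy space. -/

section Wold

variable {H : Type*} [NormedAddCommGroup H] [InnerProductSpace ℂ H] [CompleteSpace H]
  {T : H →L[ℂ] H}

theorem inner_pow_apply_of_mem_ker (hT : IsIsometryOp T) {m n : ℕ} (hmn : m ≠ n) {x y : H}
    (hx : x ∈ (adjoint T).ker) (hy : y ∈ (adjoint T).ker) :
    inner ℂ ((T ^ m) x) ((T ^ n) y) = 0 := by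
  have key : ∀ {m k : ℕ} {x y : H}, x ∈ (adjoint T).ker →
      inner ℂ ((T ^ m) x) ((T ^ (m + (k + 1))) y) = 0 := by
    intro m k x y hx
    have hx' : adjoint T x = 0 := hx
    rw [pow_add, mul_apply_eq_comp, (hT.pow m).inner_map, pow_succ', mul_apply_eq_comp,
      ← ContinuousLinearMap.adjoint_inner_left, hx', inner_zero_left]
  rcases lt_or_gt_of_ne hmn with h | h
  · obtain ⟨k, rfl⟩ := Nat.exists_eq_add_of_lt h
    exact key hx
  · obtain ⟨k, rfl⟩ := Nat.exists_eq_add_of_lt h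
    rw [← inner_conj_symm]
    simp only [add_assoc]
    rw [key hy, map_zero]

theorem orthogonalFamily_wandering (hT : IsIsometryOp T) :
    OrthogonalFamily ℂ (fun _ : ℕ => (adjoint T).ker) (fun n =>
      (⟨((T ^ n : H →L[ℂ] H) : H →ₗ[ℂ] H) ∘ₗ (adjoint T).ker.subtype,
        fun x => (hT.pow n).norm_map x⟩ : (adjoint T).ker →ₗᵢ[ℂ] H)) :=
  fun _ _ hmn x y => inner_pow_apply_of_mem_ker hT hmn x.2 y.2

/-- The Wold isometry `∑ aₙ zⁿ ↦ ∑ Tⁿ aₙ` of an isometry `T`. -/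
noncomputable def wold (hT : IsIsometryOp T) : HardySpace (adjoint T).ker →ₗᵢ[ℂ] H :=
  (orthogonalFamily_wandering hT).linearIsometry

theorem wold_hasSum (hT : IsIsometryOp T) (f : HardySpace (adjoint T).ker) :
    HasSum (fun n : ℕ => (T ^ n) (f n : H)) (wold hT f) :=
  (orthogonalFamily_wandering hT).hasSum_linearIsometry f

theorem wold_single (hT : IsIsometryOp T) (n : ℕ) (x : (adjoint T).ker) :
    wold hT (lp.single 2 n x) = (T ^ n) (x : H) :=
  (orthogonalFamily_wandering hT).linearIsometry_apply_single x

theorem inner_pow_apply_wold (hT : IsIsometryOp T) (n : ℕ) (x : (adjoint T).ker)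
    (f : HardySpace (adjoint T).ker) :
    inner ℂ ((T ^ n) (x : H)) (wold hT f) = inner ℂ x (f n) := by
  rw [← wold_single hT, (wold hT).inner_map_map, lp.inner_single_left]

/-- A vector orthogonal to every `Tⁿ ker T*` climbs the ranges one by one: if it equals `Tⁿ y`,
orthogonality kills the component `y - T T* y` of `y` in `ker T*`, so it lies in the range of `T ^
(n + 1)`. Conversely, that range is orthogonal to `Tⁿ ker T*`. -/
theorem orthogonal_range_wold (hT : IsIsometryOp T) :
    (LinearMap.range (wold hT).toLinearMap)ᗮ = hyperRange T := by
  ext x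
  rw [Submodule.mem_orthogonal, mem_hyperRange_iff]
  constructor
  · intro h n
    have h1 : ∀ (n : ℕ) (e : (adjoint T).ker), inner ℂ ((T ^ n) (e : H)) x = 0 :=
      fun n e => h _ ⟨lp.single 2 n e, wold_single hT n e⟩
    induction n with
    | zero => exact ⟨x, by simp⟩
    | succ n ih =>
      obtain ⟨y, rfl⟩ := ih
      have h2 : adjoint T (y - T (adjoint T y)) = 0 := by
        rw [map_sub, isIsometryOp_iff.1 hT, sub_self]
      have h3 := h1 n ⟨_, h2⟩
      rw [(hT.pow n).inner_map] at h3
      have h4 : inner ℂ (y - T (adjoint T y)) (T (adjoint T y)) = 0 := by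
        rw [← ContinuousLinearMap.adjoint_inner_left, h2, inner_zero_left]
      have h5 : inner ℂ (y - T (adjoint T y)) (y - T (adjoint T y)) = 0 := by
        rw [inner_sub_right, h4, sub_zero]
        exact h3
      have h6 : y = T (adjoint T y) := sub_eq_zero.1 (inner_self_eq_zero.1 h5)
      exact ⟨adjoint T y, by rw [pow_succ, mul_apply_eq_comp, ← h6]⟩
  · rintro h _ ⟨f, rfl⟩
    have h1 : HasSum (fun n : ℕ => inner ℂ x ((T ^ n) (f n : H))) (inner ℂ x (wold hT f)) :=
      (innerSL ℂ x).hasSum (wold_hasSum hT f)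
    have h2 : ∀ n : ℕ, inner ℂ x ((T ^ n) (f n : H)) = 0 := by
      intro n
      obtain ⟨y, rfl⟩ := h (n + 1)
      have h3 : adjoint T (f n : H) = 0 := (f n).2
      rw [pow_succ, mul_apply_eq_comp, (hT.pow n).inner_map,
        ← ContinuousLinearMap.adjoint_inner_right, h3, inner_zero_right]
    simp only [h2] at h1
    rw [← inner_conj_symm]
    have h4 : inner ℂ x (wold hT f) = 0 := h1.unique hasSum_zero
    exact (congrArg (starRingEnd ℂ) h4).trans (map_zero _)

/-- **Wold decomposition**: the range of the Wold isometry is the orthogonal complement of the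
hyper-range. -/
theorem range_wold (hT : IsIsometryOp T) :
    LinearMap.range (wold hT).toLinearMap = (hyperRange T)ᗮ := by
  have hcl : IsClosed (LinearMap.range (wold hT).toLinearMap : Set H) := by
    rw [LinearMap.coe_range]
    exact (wold hT).isometry.isClosedEmbedding.isClosed_range
  have : CompleteSpace (LinearMap.range (wold hT).toLinearMap) := hcl.completeSpace_coe
  rw [← orthogonal_range_wold hT, Submodule.orthogonal_orthogonal]

theorem wold_mem (hT : IsIsometryOp T) (f : HardySpace (adjoint T).ker) :
    wold hT f ∈ (hyperRange T)ᗮ := by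
  rw [← range_wold hT]
  exact ⟨f, rfl⟩

/-- The operator on the Hardy space which corresponds to `N` under the Wold isometry. -/
noncomputable def woldConj (hT : IsIsometryOp T) (N : H →L[ℂ] H) :
    HardySpace (adjoint T).ker →L[ℂ] HardySpace (adjoint T).ker :=
  adjoint (wold hT).toContinuousLinearMap ∘L N ∘L (wold hT).toContinuousLinearMap

/-- The adjoint of the Wold isometry inverts it only on its range, the complement of the
hyper-range, and invariance keeps `N` there. -/
theorem wold_woldConj (hT : IsIsometryOp T) {N : H →L[ℂ] H}
    (hN : InvariantFor (hyperRange T)ᗮ N) (f : HardySpace (adjoint T).ker) :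
    wold hT (woldConj hT N f) = N (wold hT f) := by
  have h1 := hN _ (wold_mem hT f)
  rw [← range_wold hT] at h1
  obtain ⟨g, hg⟩ := h1
  have hg : wold hT g = N (wold hT f) := hg
  have h2 : woldConj hT N f = g := by
    refine ext_inner_left ℂ fun k => ?_
    simp only [woldConj, ContinuousLinearMap.comp_apply]
    rw [ContinuousLinearMap.adjoint_inner_right, LinearIsometry.coe_toContinuousLinearMap, ← hg,
      (wold hT).inner_map_map]
  rw [h2, hg]

theorem inner_woldConj_apply (hT : IsIsometryOp T) {N : H →L[ℂ] H}
    (hN : InvariantFor (hyperRange T)ᗮ N) (f : HardySpace (adjoint T).ker) (n : ℕ)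
    (x : (adjoint T).ker) :
    inner ℂ x (woldConj hT N f n) = inner ℂ ((T ^ n) (x : H)) (N (wold hT f)) := by
  rw [← inner_pow_apply_wold hT, wold_woldConj hT hN]

theorem woldConj_mul (hT : IsIsometryOp T) {A B : H →L[ℂ] H}
    (hA : InvariantFor (hyperRange T)ᗮ A) (hB : InvariantFor (hyperRange T)ᗮ B) :
    woldConj hT (A * B) = woldConj hT A * woldConj hT B := by
  refine ContinuousLinearMap.ext fun f => (wold hT).injective ?_
  rw [wold_woldConj hT (fun x hx => hA (B x) (hB x hx)), mul_apply_eq_comp, mul_apply_eq_comp,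
    wold_woldConj hT hA, wold_woldConj hT hB]

theorem norm_woldConj (hT : IsIsometryOp T) {N : H →L[ℂ] H} (hNi : IsIsometryOp N)
    (hN : InvariantFor (hyperRange T)ᗮ N) (f : HardySpace (adjoint T).ker) :
    ‖woldConj hT N f‖ = ‖f‖ := by
  rw [← (wold hT).norm_map, wold_woldConj hT hN, hNi.norm_map, (wold hT).norm_map]

/-- `T` carries `Tⁿ ker T*` to `T ^ (n + 1) ker T*`, so the Taylor coefficients move up by one
place. -/
theorem isMulOp_coordFun_woldConj (hT : IsIsometryOp T) :
    IsMulOp (coordFun (adjoint T).ker) (woldConj hT T) := by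
  intro f z hz
  have hN := hT.reduces_hyperRange.2
  have h0 : woldConj hT T f 0 = 0 := by
    refine ext_inner_left ℂ fun x => ?_
    have hx : adjoint T (x : H) = 0 := x.2
    rw [inner_woldConj_apply hT hN, pow_zero, inner_zero_right, one_apply_eq_self,
      ← ContinuousLinearMap.adjoint_inner_left, hx, inner_zero_left]
  have h1 : ∀ n : ℕ, woldConj hT T f (n + 1) = f n := by
    intro n
    refine ext_inner_left ℂ fun x => ?_
    rw [inner_woldConj_apply hT hN, pow_succ', mul_apply_eq_comp, hT.inner_map,
      inner_pow_apply_wold]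
  have h2 := hardyEval_hasSum (woldConj hT T f) hz
  rw [← hasSum_nat_add_iff' 1] at h2
  simp only [Finset.range_one, Finset.sum_singleton, h0, smul_zero, sub_zero, h1] at h2
  refine h2.unique (((hardyEval_hasSum f hz).const_smul z).congr_fun fun n => ?_)
  rw [smul_smul, pow_succ']

theorem isMulOp_woldConj (hT : IsIsometryOp T) {N : H →L[ℂ] H} (hNT : N * T = T * N)
    (hN : InvariantFor (hyperRange T)ᗮ N) :
    IsMulOp (hardySymbol (E := (adjoint T).ker) (woldConj hT N)) (woldConj hT N) := by
  refine isMulOp_hardySymbol (E := (adjoint T).ker) (isMulOp_coordFun_woldConj hT) ?_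
  rw [← woldConj_mul hT hN hT.reduces_hyperRange.2, hNT,
    woldConj_mul hT hT.reduces_hyperRange.2 hN]

theorem invariantFor_ker_adjoint {N : H →L[ℂ] H} (h : adjoint T * N = N * adjoint T) :
    InvariantFor (adjoint T).ker N := by
  intro x hx
  have hx' : adjoint T x = 0 := hx
  change (adjoint T) (N x) = 0
  rw [← mul_apply_eq_comp, h, mul_apply_eq_comp, hx', map_zero]

/-- An operator which doubly commutes with `T` corresponds to a constant multiplication. -/
theorem isMulOp_const_woldConj (hT : IsIsometryOp T) {N : H →L[ℂ] H} (hNT : N * T = T * N)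
    (hd : adjoint T * N = N * adjoint T) :
    IsMulOp (fun _ => restrictOp (adjoint T).ker N (invariantFor_ker_adjoint hd))
      (woldConj hT N) := by
  have hadj : adjoint T * adjoint N = adjoint N * adjoint T := by
    have := congrArg adjoint hNT
    simpa only [ContinuousLinearMap.mul_def, ContinuousLinearMap.adjoint_comp] using this
  have hd' : adjoint N * T = T * adjoint N := by
    have := congrArg adjoint hd
    simpa only [ContinuousLinearMap.mul_def, ContinuousLinearMap.adjoint_comp,
      ContinuousLinearMap.adjoint_adjoint] using this
  have hN : InvariantFor (hyperRange T)ᗮ N :=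
    (invariantFor_hyperRange_of_commute hd').orthogonal_of_adjoint
  have hc : ∀ (n : ℕ) (x : H), adjoint N ((T ^ n) x) = (T ^ n) (adjoint N x) := by
    intro n x
    have h1 : adjoint N * T ^ n = T ^ n * adjoint N :=
      (show Commute (adjoint N) T from hd').pow_right n
    rw [← mul_apply_eq_comp, h1, mul_apply_eq_comp]
  intro f z hz
  have h1 : ∀ n : ℕ, woldConj hT N f n =
      restrictOp (adjoint T).ker N (invariantFor_ker_adjoint hd) (f n) := by
    intro n
    refine ext_inner_left ℂ fun x => ?_
    rw [inner_woldConj_apply hT hN, ← ContinuousLinearMap.adjoint_inner_left, hc]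
    have h2 := inner_pow_apply_wold hT n ⟨_, invariantFor_ker_adjoint hadj x x.2⟩ f
    rw [h2, Submodule.coe_inner, Submodule.coe_inner, coe_restrictOp_apply,
      ContinuousLinearMap.adjoint_inner_left]
  refine (hardyEval_hasSum _ hz).unique ?_
  refine ((restrictOp (adjoint T).ker N (invariantFor_ker_adjoint hd)).hasSum
    (hardyEval_hasSum f hz)).congr_fun fun n => ?_
  rw [h1, map_smul]

end Wold

/-! ### Unitary equivalence with orthogonal sums. -/

section Equivalence

variable {H K L : Type*} [NormedAddCommGroup H] [InnerProductSpace ℂ H]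
  [NormedAddCommGroup K] [InnerProductSpace ℂ K] [NormedAddCommGroup L] [InnerProductSpace ℂ L]

/-- The isometry `j ⊕ l` of two isometries with orthogonal ranges. -/
noncomputable def sumIsometry (j : K →ₗᵢ[ℂ] H) (l : L →ₗᵢ[ℂ] H)
    (h : ∀ a b, inner ℂ (j a) (l b) = 0) : WithLp 2 (K × L) →ₗᵢ[ℂ] H where
  toFun p := j p.fst + l p.snd
  map_add' p q := by
    simp only [WithLp.add_fst, WithLp.add_snd, map_add]
    abel
  map_smul' c p := by
    simp only [WithLp.smul_fst, WithLp.smul_snd, map_smul, smul_add, RingHom.id_apply]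
  norm_map' p := by
    have h1 : ‖j p.fst + l p.snd‖ ^ 2 = ‖p‖ ^ 2 := by
      rw [WithLp.prod_norm_sq_eq_of_L2, ← j.norm_map p.fst, ← l.norm_map p.snd, pow_two, pow_two,
        pow_two]
      exact norm_add_sq_eq_norm_sq_add_norm_sq_of_inner_eq_zero _ _ (h _ _)
    exact (pow_left_inj₀ (norm_nonneg _) (norm_nonneg _) two_ne_zero).1 h1

theorem sumIsometry_apply (j : K →ₗᵢ[ℂ] H) (l : L →ₗᵢ[ℂ] H)
    (h : ∀ a b, inner ℂ (j a) (l b) = 0) (p : WithLp 2 (K × L)) :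
    sumIsometry j l h p = j p.fst + l p.snd := rfl

theorem sumIsometry_opSum {j : K →ₗᵢ[ℂ] H} {l : L →ₗᵢ[ℂ] H}
    (h : ∀ a b, inner ℂ (j a) (l b) = 0) {S : H →L[ℂ] H} {A : K →L[ℂ] K} {B : L →L[ℂ] L}
    (hA : ∀ a, j (A a) = S (j a)) (hB : ∀ b, l (B b) = S (l b)) (p : WithLp 2 (K × L)) :
    sumIsometry j l h (opSum A B p) = S (sumIsometry j l h p) := by
  rw [sumIsometry_apply, sumIsometry_apply, map_add, ← hA, ← hB]
  rfl

theorem pairUnitarilyEquivalent_of_surjective {S₁ S₂ : H →L[ℂ] H} {A₁ A₂ : K →L[ℂ] K}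
    (J : K →ₗᵢ[ℂ] H) (hJ : Function.Surjective J) (h₁ : ∀ a, J (A₁ a) = S₁ (J a))
    (h₂ : ∀ a, J (A₂ a) = S₂ (J a)) : PairUnitarilyEquivalent S₁ S₂ A₁ A₂ := by
  let W := LinearIsometryEquiv.ofSurjective J hJ
  refine ⟨W.symm, fun x => ?_⟩
  obtain ⟨a, rfl⟩ := W.surjective x
  simp only [LinearIsometryEquiv.symm_apply_apply]
  constructor
  · rw [LinearIsometryEquiv.symm_apply_eq]
    exact (h₁ a).symm
  · rw [LinearIsometryEquiv.symm_apply_eq]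
    exact (h₂ a).symm

end Equivalence

/-! ### The functional model. -/

section Model

variable {H : Type u} [NormedAddCommGroup H] [InnerProductSpace ℂ H] [CompleteSpace H]

/-- The elementary case of Fuglede's theorem: insert `U U* = 1` on the right, move `U` across `B`,
and cancel `U* U`. -/
theorem adjoint_mul_eq_of_commute_unitary {U B : H →L[ℂ] H} (hU : U ∈ unitary (H →L[ℂ] H))
    (h : U * B = B * U) : adjoint U * B = B * adjoint U := by
  rw [Unitary.mem_iff, ContinuousLinearMap.star_eq_adjoint] at hU
  calc adjoint U * B = adjoint U * B * (U * adjoint U) := by rw [hU.2, mul_one]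
    _ = adjoint U * (B * U) * adjoint U := by noncomm_ring
    _ = (adjoint U * U) * B * adjoint U := by rw [← h]; noncomm_ring
    _ = B * adjoint U := by rw [hU.1, one_mul]

theorem adjoint_mul_eq_adjoint_mul_symm {A B : H →L[ℂ] H} (h : adjoint A * B = B * adjoint A) :
    adjoint B * A = A * adjoint B := by
  have := congrArg adjoint h
  simpa only [ContinuousLinearMap.mul_def, ContinuousLinearMap.adjoint_comp,
    ContinuousLinearMap.adjoint_adjoint] using this

/-- `S*` removes one factor `S` and the leftover `R` slides to the right: `S* (S R) ^ (n + 1) y = (S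
R) ^ n (R y)`. -/
theorem invariantFor_hyperRange_mul_adjoint {S R : H →L[ℂ] H} (hS : IsIsometryOp S)
    (h : S * R = R * S) : InvariantFor (hyperRange (S * R)) (adjoint S) := by
  intro x hx
  rw [mem_hyperRange_iff] at hx ⊢
  intro n
  obtain ⟨y, rfl⟩ := hx (n + 1)
  have h1 : R * (S * R) = (S * R) * R := by rw [← mul_assoc, ← h]
  have h2 : R * (S * R) ^ n = (S * R) ^ n * R := (show Commute R (S * R) from h1).pow_right n
  refine ⟨R y, ?_⟩
  rw [pow_succ', mul_apply_eq_comp, mul_apply_eq_comp, isIsometryOp_iff.1 hS,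
    ← mul_apply_eq_comp, ← mul_apply_eq_comp, h2]

theorem apply_adjoint_of_mem_hyperRange_mul {S R : H →L[ℂ] H} (hS : IsIsometryOp S) {x : H}
    (hx : x ∈ hyperRange (S * R)) : S (adjoint S x) = x := by
  obtain ⟨y, rfl⟩ := mem_hyperRange_iff.1 hx 1
  rw [pow_one, mul_apply_eq_comp, isIsometryOp_iff.1 hS]

theorem hyperRange_mul_le {H : Type*} [NormedAddCommGroup H] [InnerProductSpace ℂ H]
    {S R : H →L[ℂ] H} (h : S * R = R * S) : hyperRange (S * R) ≤ hyperRange S := by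
  intro x hx
  rw [mem_hyperRange_iff] at hx ⊢
  intro n
  obtain ⟨y, rfl⟩ := hx n
  exact ⟨(R ^ n) y, by rw [(show Commute S R from h).mul_pow, mul_apply_eq_comp]⟩

theorem invariantFor_adjoint_pow {M : Submodule ℂ H} {T : H →L[ℂ] H}
    (h : InvariantFor M (adjoint T)) (n : ℕ) : InvariantFor M (adjoint (T ^ n)) := by
  have := h.pow n
  rwa [← ContinuousLinearMap.star_eq_adjoint, ← star_pow] at this

/-- The hyper-range of the restriction of `S₂` to the hyper-range of `S₁`. -/
theorem mem_hyperRange_restrictOp_iff {S₁ S₂ : H →L[ℂ] H} (hS : IsBiIsometry S₁ S₂)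
    (hR : Reduces (hyperRange S₁) S₂) [CompleteSpace (hyperRange S₁)] (x : hyperRange S₁) :
    x ∈ hyperRange (restrictOp (hyperRange S₁) S₂ hR.1) ↔ (x : H) ∈ hyperRange (S₁ * S₂) := by
  obtain ⟨hc, h1, h2⟩ := hS
  have hpow : ∀ n, (S₁ * S₂) ^ n = S₂ ^ n * S₁ ^ n := fun n => by
    rw [hc, (show Commute S₂ S₁ from hc.symm).mul_pow]
  rw [mem_hyperRange_iff, mem_hyperRange_iff]
  refine forall_congr' fun n => ⟨?_, ?_⟩
  · rintro ⟨y, rfl⟩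
    obtain ⟨z, hz⟩ := mem_hyperRange_iff.1 y.2 n
    exact ⟨z, by rw [hpow, mul_apply_eq_comp, hz, coe_restrictOp_pow_apply]⟩
  · rintro ⟨y, hy⟩
    -- The only possible preimage of `x` under `S₂ ^ n`; it stays in the hyper-range of `S₁` because
    -- a reducing subspace is invariant for the adjoint.
    refine ⟨⟨adjoint (S₂ ^ n) x, invariantFor_adjoint_pow hR.adjoint n _ x.2⟩, ?_⟩
    refine Subtype.ext ?_
    rw [coe_restrictOp_pow_apply]
    simp only
    rw [← hy, hpow, mul_apply_eq_comp, isIsometryOp_iff.1 (h2.pow n)]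

set_option maxHeartbeats 2000000 in
/-- The functional model of a bi-isometry for which the hyper-range of `S₁` reduces `S₂`. -/
theorem exists_model {S₁ S₂ : H →L[ℂ] H} (hS : IsBiIsometry S₁ S₂)
    (hR : Reduces (hyperRange S₁) S₂) [CompleteSpace (hyperRange S₁)] :
      ∃ (φ : ℂ → ((adjoint S₁).ker →L[ℂ] (adjoint S₁).ker))
        (F : Type u) (_ : NormedAddCommGroup F) (_ : InnerProductSpace ℂ F) (_ : CompleteSpace F)
        (ψ : ℂ → (F →L[ℂ] F))
        (Huu : Submodule ℂ H) (_ : CompleteSpace Huu)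
        (V₁ V₂ : Huu →L[ℂ] Huu)
        (Mψ MzF : HardySpace F →L[ℂ] HardySpace F)
        (MzE Mφ : HardySpace (adjoint S₁).ker →L[ℂ] HardySpace (adjoint S₁).ker),
        IsInner φ ∧ IsConstUnitary ψ ∧ Huu ≤ hyperRange S₁ ∧ IsBiUnitary V₁ V₂ ∧
        IsMulOp ψ Mψ ∧ IsMulOp (coordFun F) MzF ∧
        IsMulOp (coordFun (adjoint S₁).ker) MzE ∧ IsMulOp φ Mφ ∧
        PairUnitarilyEquivalent S₁ S₂
          (opSum V₁ (opSum Mψ MzE)) (opSum V₂ (opSum MzF Mφ)) := by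
  obtain ⟨hc, h1, h2⟩ := id hS
  set M := hyperRange S₁ with hM
  have hR1 : Reduces M S₁ := h1.reduces_hyperRange
  -- the restrictions to the hyper-range
  set U := restrictOp M S₁ hR1.1 with hUdef
  set B := restrictOp M S₂ hR.1 with hBdef
  have hU : U ∈ unitary (M →L[ℂ] M) := restrictOp_mem_unitary h1 hR1.1
    h1.invariantFor_hyperRange_adjoint fun x hx => h1.apply_adjoint_of_mem_hyperRange hx
  have hUi : IsIsometryOp U := h1.restrictOp _
  have hB : IsIsometryOp B := h2.restrictOp _
  have hUB : U * B = B * U := by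
    ext x
    exact congrArg (fun A : H →L[ℂ] H => A x) hc
  have hdB : adjoint B * U = U * adjoint B :=
    adjoint_mul_eq_adjoint_mul_symm (adjoint_mul_eq_of_commute_unitary hU hUB)
  have hdB' : adjoint B * adjoint U = adjoint U * adjoint B := by
    have := congrArg adjoint hUB
    simpa only [ContinuousLinearMap.mul_def, ContinuousLinearMap.adjoint_comp] using this
  -- `U*` commutes with `B` and so preserves its hyper-range; dually, `U` preserves the complement.
  have hUinv : InvariantFor (hyperRange B)ᗮ U :=
    (invariantFor_hyperRange_of_commute
      (adjoint_mul_eq_of_commute_unitary hU hUB)).orthogonal_of_adjoint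
  -- the bi-unitary part
  have hT : IsIsometryOp (S₁ * S₂) := h1.mul h2
  -- This is the hyper-range of `B` seen inside `H`, by `mem_hyperRange_restrictOp_iff`. As the
  -- hyper-range of the product it is symmetric in `S₁` and `S₂`, so one argument shows that both
  -- are unitary on it.
  set Huu := hyperRange (S₁ * S₂) with hHuu
  have hHuuM : Huu ≤ M := hyperRange_mul_le hc
  have hcomp : CompleteSpace Huu := hT.completeSpace_hyperRange
  have hi1 : InvariantFor Huu S₁ :=
    invariantFor_hyperRange_of_commute (by rw [mul_assoc, hc])
  have hi2 : InvariantFor Huu S₂ :=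
    invariantFor_hyperRange_of_commute (by rw [← mul_assoc, hc])
  have hV1 : restrictOp Huu S₁ hi1 ∈ unitary (Huu →L[ℂ] Huu) :=
    restrictOp_mem_unitary h1 hi1 (invariantFor_hyperRange_mul_adjoint h1 hc)
      fun x hx => apply_adjoint_of_mem_hyperRange_mul h1 hx
  have hV2 : restrictOp Huu S₂ hi2 ∈ unitary (Huu →L[ℂ] Huu) := by
    refine restrictOp_mem_unitary h2 hi2 ?_ fun x hx => ?_
    · rw [hHuu, hc]
      exact invariantFor_hyperRange_mul_adjoint h2 hc.symm
    · rw [hHuu, hc] at hx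
      exact apply_adjoint_of_mem_hyperRange_mul h2 hx
  -- the three orthogonal summands
  set jF : HardySpace (adjoint B).ker →ₗᵢ[ℂ] H := M.subtypeₗᵢ.comp (wold hB) with hjF
  have hjF_apply : ∀ f, jF f = ((wold hB f : M) : H) := fun _ => rfl
  have hFE : ∀ f g, inner ℂ (jF f) (wold h1 g) = 0 := fun f g =>
    (Submodule.mem_orthogonal _ _).1 (wold_mem h1 g) _ (wold hB f).2
  set jFE := sumIsometry jF (wold h1) hFE with hjFE
  have huFE : ∀ (a : Huu) p, inner ℂ (Huu.subtypeₗᵢ a) (jFE p) = 0 := by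
    intro a p
    rw [hjFE, sumIsometry_apply, inner_add_right]
    have ha : (⟨a, hHuuM a.2⟩ : M) ∈ hyperRange B :=
      (mem_hyperRange_restrictOp_iff hS hR ⟨a, hHuuM a.2⟩).2 a.2
    have e1 : inner ℂ (a : H) (jF p.fst) = 0 :=
      (Submodule.mem_orthogonal _ _).1 (wold_mem hB p.fst) _ ha
    have e2 : inner ℂ (a : H) (wold h1 p.snd) = 0 :=
      (Submodule.mem_orthogonal _ _).1 (wold_mem h1 p.snd) _ (hHuuM a.2)
    rw [Submodule.coe_subtypeₗᵢ, Submodule.subtype_apply, e1, e2, add_zero]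
  have hsurj : Function.Surjective (sumIsometry Huu.subtypeₗᵢ jFE huFE) := by
    intro x
    -- Two Wold decompositions in turn: of `S₁` on `H`, then of `B` on the hyper-range of `S₁`.
    obtain ⟨m, hm, p, hp, rfl⟩ := M.exists_add_mem_mem_orthogonal x
    have hcB : CompleteSpace (hyperRange B) := hB.completeSpace_hyperRange
    obtain ⟨u, hu, q, hq, huq⟩ := (hyperRange B).exists_add_mem_mem_orthogonal ⟨m, hm⟩
    rw [← range_wold h1] at hp
    rw [← range_wold hB] at hq
    obtain ⟨g, rfl⟩ := hp
    obtain ⟨f, rfl⟩ := hq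
    refine ⟨WithLp.toLp 2 (⟨u, (mem_hyperRange_restrictOp_iff hS hR u).1 hu⟩,
      WithLp.toLp 2 (f, g)), ?_⟩
    have h3 : m = (u : H) + jF f := congrArg Subtype.val huq
    rw [h3, add_assoc]
    rfl
  have hcF : CompleteSpace (adjoint B).ker := inferInstance
  refine ⟨hardySymbol (E := (adjoint S₁).ker) (woldConj h1 S₂), (adjoint B).ker, inferInstance,
    inferInstance, hcF, fun _ => restrictOp (adjoint B).ker U (invariantFor_ker_adjoint hdB),
    Huu, hcomp, restrictOp Huu S₁ hi1, restrictOp Huu S₂ hi2, woldConj hB U, woldConj hB B,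
    woldConj h1 S₁, woldConj h1 S₂, ?_, ?_, hHuuM, ⟨?_, hV1, hV2⟩, ?_, ?_, ?_, ?_, ?_⟩
  · exact isInner_hardySymbol (E := (adjoint S₁).ker) (isMulOp_woldConj h1 hc.symm hR.2)
      (norm_woldConj h1 h2 hR.2)
  · refine ⟨_, ?_, fun _ _ => rfl⟩
    refine restrictOp_mem_unitary hUi _ (invariantFor_ker_adjoint hdB') fun x _ => ?_
    rw [Unitary.mem_iff, ContinuousLinearMap.star_eq_adjoint] at hU
    rw [← mul_apply_eq_comp, hU.2, one_apply_eq_self]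
  · ext x
    exact congrArg (fun A : H →L[ℂ] H => A x) hc
  · exact isMulOp_const_woldConj hB hUB hdB
  · exact isMulOp_coordFun_woldConj hB
  · exact isMulOp_coordFun_woldConj h1
  · exact isMulOp_woldConj h1 hc.symm hR.2
  · refine pairUnitarilyEquivalent_of_surjective _ hsurj ?_ ?_
    · refine sumIsometry_opSum huFE (fun _ => rfl) ?_
      refine sumIsometry_opSum hFE (fun f => ?_) (wold_woldConj h1 hR1.2)
      rw [hjF_apply, wold_woldConj hB hUinv]
      rfl
    · refine sumIsometry_opSum huFE (fun _ => rfl) ?_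
      refine sumIsometry_opSum hFE (fun f => ?_) (wold_woldConj h1 hR.2)
      rw [hjF_apply, wold_woldConj hB hB.reduces_hyperRange.2]
      rfl

end Model

/-! ### The equivalent conditions and the recurrence argument. -/

section Criteria

open Filter

variable {H : Type*} [NormedAddCommGroup H] [InnerProductSpace ℂ H] [CompleteSpace H]

theorem InvariantFor.starProjection_apply {H : Type*} [NormedAddCommGroup H]
    [InnerProductSpace ℂ H] {M : Submodule ℂ H} [M.HasOrthogonalProjection]
    {A : H →L[ℂ] H} (h : InvariantFor M A) (h' : InvariantFor Mᗮ A) (x : H) :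
    M.starProjection (A x) = A (M.starProjection x) := by
  refine Submodule.eq_starProjection_of_mem_orthogonal (h _ (Submodule.starProjection_apply_mem _ _))
    ?_
  rw [← map_sub]
  exact h' _ (M.sub_starProjection_mem_orthogonal x)

theorem IsIsometryOp.norm_adjoint_pow_le {T : H →L[ℂ] H} (hT : IsIsometryOp T) (n : ℕ) (x : H) :
    ‖(adjoint T ^ n) x‖ ≤ ‖x‖ := by
  have h1 : ‖adjoint T‖ ≤ 1 := by
    rw [LinearIsometryEquiv.norm_map]
    exact T.opNorm_le_bound zero_le_one fun x => by rw [hT.norm_map, one_mul]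
  induction n with
  | zero => simp
  | succ n ih =>
    rw [pow_succ', mul_apply_eq_comp]
    exact ((adjoint T).le_of_opNorm_le h1 _).trans (by rwa [one_mul])

theorem IsIsometryOp.adjoint_pow_apply {T : H →L[ℂ] H} (hT : IsIsometryOp T) (n : ℕ) (x : H) :
    (adjoint T ^ n) ((T ^ n) x) = x := by
  have h := isIsometryOp_iff.1 (hT.pow n) x
  rwa [← ContinuousLinearMap.star_eq_adjoint, star_pow, ContinuousLinearMap.star_eq_adjoint] at h

theorem adjoint_pow_inner_right (T : H →L[ℂ] H) (n : ℕ) (x y : H) :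
    inner ℂ x ((adjoint T ^ n) y) = inner ℂ ((T ^ n) x) y := by
  rw [← ContinuousLinearMap.adjoint_inner_right, ← ContinuousLinearMap.star_eq_adjoint (T ^ n),
    star_pow, ContinuousLinearMap.star_eq_adjoint]

/-- A finite partial sum of the Wold expansion is annihilated by `T*ᵏ` once `k` exceeds all its
indices, and the powers of `T*` are contractions on the remainder. -/
theorem tendsto_adjoint_pow_of_mem_orthogonal {T : H →L[ℂ] H} (hT : IsIsometryOp T) {w : H}
    (hw : w ∈ (hyperRange T)ᗮ) : Tendsto (fun k => (adjoint T ^ k) w) atTop (𝓝 0) := by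
  rw [← range_wold hT] at hw
  obtain ⟨f, rfl⟩ := hw
  rw [NormedAddGroup.tendsto_nhds_zero]
  intro ε hε
  obtain ⟨s, hs⟩ := ((wold_hasSum hT f).eventually (Metric.ball_mem_nhds _ hε)).exists
  rw [dist_eq_norm, norm_sub_rev] at hs
  filter_upwards [eventually_gt_atTop (s.sup id)] with k hk
  have h0 : (adjoint T ^ k) (∑ n ∈ s, (T ^ n) (f n : H)) = 0 := by
    rw [map_sum]
    refine Finset.sum_eq_zero fun n hn => ?_
    have hnk : n < k := (Finset.le_sup (f := id) hn).trans_lt hk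
    obtain ⟨m, rfl⟩ := Nat.exists_eq_add_of_lt hnk
    have h3 : adjoint T (f n : H) = 0 := (f n).2
    rw [show n + m + 1 = m + 1 + n by ring, pow_add, mul_apply_eq_comp, hT.adjoint_pow_apply,
      pow_succ, mul_apply_eq_comp, h3, map_zero]
  have h1 := hT.norm_adjoint_pow_le k (wold hT f - ∑ n ∈ s, (T ^ n) (f n : H))
  rw [map_sub, h0, sub_zero] at h1
  exact h1.trans_lt hs

/-- For `x` in the wandering subspace, the component of `S₂ x` in the hyper-range of `S₁` has an
orbit which tends weakly to zero along itself. -/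
theorem tendsto_inner_pow_starProjection {S₁ S₂ : H →L[ℂ] H} (hS : IsBiIsometry S₁ S₂)
    [CompleteSpace (hyperRange S₁)] {x : H} (hx : x ∈ (adjoint S₁).ker) :
    Tendsto (fun k => inner ℂ ((S₁ ^ k) ((hyperRange S₁).starProjection (S₂ x)))
      ((hyperRange S₁).starProjection (S₂ x))) atTop (𝓝 0) := by
  obtain ⟨hc, h1, h2⟩ := hS
  set y := (hyperRange S₁).starProjection (S₂ x) with hy
  set w := S₂ x - y with hw
  have hyM : y ∈ hyperRange S₁ := Submodule.starProjection_apply_mem _ _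
  have hwM : w ∈ (hyperRange S₁)ᗮ := (hyperRange S₁).sub_starProjection_mem_orthogonal _
  have hR := h1.reduces_hyperRange
  have hlim : Tendsto (fun k => -inner ℂ w ((adjoint S₁ ^ k) w)) atTop (𝓝 0) := by
    have h := (tendsto_adjoint_pow_of_mem_orthogonal h1 hwM)
    have h3 := ((innerSL ℂ w).continuous.tendsto 0).comp h
    rw [map_zero] at h3
    simpa using h3.neg
  have hlim2 : Tendsto (fun k => -inner ℂ ((S₁ ^ k) w) w) atTop (𝓝 0) :=
    hlim.congr fun k => by rw [adjoint_pow_inner_right]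
  refine hlim2.congr' ?_
  filter_upwards [eventually_gt_atTop 0] with k hk
  obtain ⟨m, rfl⟩ := Nat.exists_eq_succ_of_ne_zero hk.ne'
  have hsum : S₂ x = y + w := by rw [hw]; abel
  have hx' : adjoint S₁ x = 0 := hx
  -- `S₂` commutes with `S₁` and drops out of the inner product, leaving `⟨S₁ᵏ x, x⟩`. This vanishes
  -- since `k ≥ 1` and `S₁* x = 0`.
  have h0 : inner ℂ ((S₁ ^ (m + 1)) (S₂ x)) (S₂ x) = 0 := by
    have hcm : S₁ ^ (m + 1) * S₂ = S₂ * S₁ ^ (m + 1) := (show Commute S₁ S₂ from hc).pow_left _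
    rw [← mul_apply_eq_comp, hcm, mul_apply_eq_comp, h2.inner_map, pow_succ', mul_apply_eq_comp,
      ← ContinuousLinearMap.adjoint_inner_right, hx', inner_zero_right]
  have e1 : inner ℂ ((S₁ ^ (m + 1)) y) w = 0 :=
    (Submodule.mem_orthogonal _ _).1 hwM _ (hR.1.pow _ _ hyM)
  have e2 : inner ℂ ((S₁ ^ (m + 1)) w) y = 0 :=
    (Submodule.mem_orthogonal' _ _).1 (hR.2.pow _ _ hwM) _ hyM
  rw [hsum, map_add, inner_add_left, inner_add_right, inner_add_right, e1, e2, add_zero,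
    zero_add] at h0
  exact neg_eq_of_add_eq_zero_left h0

/-- In `⟨y, y⟩ = ⟨Tᵏ y, y⟩ - ⟨Tᵏ y - y, y⟩`, some large `k` makes each term on the right smaller
than `‖y‖² / 2` unless `y = 0`. -/
theorem eq_zero_of_recurrent {H : Type*} [NormedAddCommGroup H] [InnerProductSpace ℂ H]
    {T : H →L[ℂ] H} {y : H}
    (h0 : Tendsto (fun k => inner ℂ ((T ^ k) y) y) atTop (𝓝 0))
    (hrec : ∀ ε > 0, ∀ N : ℕ, ∃ k ≥ N, ‖(T ^ k) y - y‖ < ε) : y = 0 := by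
  by_contra hy
  have hpos : 0 < ‖y‖ := norm_pos_iff.2 hy
  have h1 : ∀ᶠ k in atTop, ‖inner ℂ ((T ^ k) y) y‖ < ‖y‖ ^ 2 / 2 :=
    (NormedAddGroup.tendsto_nhds_zero.1 h0) _ (by positivity)
  obtain ⟨N, hN⟩ := eventually_atTop.1 h1
  obtain ⟨k, hk, hky⟩ := hrec (‖y‖ / 2) (by positivity) N
  have h2 := hN k hk
  have h3 : ‖(inner ℂ y y : ℂ)‖ ≤ ‖inner ℂ ((T ^ k) y) y‖ + ‖(T ^ k) y - y‖ * ‖y‖ := by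
    have h4 : (inner ℂ y y : ℂ) = inner ℂ ((T ^ k) y) y - inner ℂ ((T ^ k) y - y) y := by
      rw [inner_sub_left]; ring
    rw [h4]
    refine (norm_sub_le _ _).trans ?_
    gcongr
    exact norm_inner_le_norm _ _
  rw [inner_self_eq_norm_sq_to_K] at h3
  have h5 : ‖y‖ ^ 2 ≤ ‖inner ℂ ((T ^ k) y) y‖ + ‖(T ^ k) y - y‖ * ‖y‖ := by simpa using h3
  nlinarith

/-- A sequence in a compact set returns near itself after arbitrarily long gaps. -/
theorem exists_gap_lt_of_isCompact {X : Type*} [PseudoMetricSpace X] {s : Set X} (hs : IsCompact s)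
    {u : ℕ → X} (hu : ∀ n, u n ∈ s) {ε : ℝ} (hε : 0 < ε) (N : ℕ) :
    ∃ j k, N ≤ k ∧ dist (u (j + k)) (u j) < ε := by
  obtain ⟨a, -, φ, hφ, hlim⟩ := hs.tendsto_subseq hu
  obtain ⟨i₀, hi₀⟩ := Metric.tendsto_atTop.1 hlim (ε / 2) (by positivity)
  -- A strictly increasing `φ` satisfies `φ i ≥ i`, so the gap `φ i - φ i₀` is at least `N`.
  set i := i₀ + (φ i₀ + N) with hi
  have h1 : φ i₀ + N ≤ φ i := (Nat.le_add_left _ _).trans (hφ.le_apply (x := i))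
  refine ⟨φ i₀, φ i - φ i₀, by omega, ?_⟩
  rw [Nat.add_sub_cancel' (by omega)]
  have h2 := hi₀ i (Nat.le_add_right _ _)
  have h3 := hi₀ i₀ le_rfl
  have := dist_triangle_right (u (φ i)) (u (φ i₀)) a
  simp only [Function.comp_apply] at h2 h3
  linarith

variable {S₁ S₂ : H →L[ℂ] H}

theorem isOrtho_map_ker_of_starProjection_eq_zero [CompleteSpace (hyperRange S₁)]
    (h : ∀ x ∈ (adjoint S₁).ker, (hyperRange S₁).starProjection (S₂ x) = 0) :
    ((adjoint S₁).ker.map (S₂ : H →ₗ[ℂ] H)) ⟂ hyperRange S₁ := by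
  rw [Submodule.isOrtho_iff_le]
  rintro _ ⟨x, hx, rfl⟩
  exact (Submodule.starProjection_apply_eq_zero_iff _).1 (h x hx)

/-- For `m` in the hyper-range and `e` in the kernel, `⟨m, S₂ S₁ⁿ e⟩ = ⟨S₁*ⁿ m, S₂ e⟩`, and `S₁*ⁿ m`
is still in the hyper-range. The Wold expansion extends this to the whole complement. -/
theorem reduces_of_isOrtho (hS : IsBiIsometry S₁ S₂)
    (h : ((adjoint S₁).ker.map (S₂ : H →ₗ[ℂ] H)) ⟂ hyperRange S₁) :
    Reduces (hyperRange S₁) S₂ := by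
  obtain ⟨hc, h1, h2⟩ := hS
  refine ⟨invariantFor_hyperRange_of_commute hc.symm, fun x hx => ?_⟩
  rw [← range_wold h1] at hx
  obtain ⟨f, rfl⟩ := hx
  rw [Submodule.mem_orthogonal]
  intro m hm
  have hs : HasSum (fun n : ℕ => inner ℂ m (S₂ ((S₁ ^ n) (f n : H))))
      (inner ℂ m (S₂ (wold h1 f))) :=
    (innerSL ℂ m ∘L S₂).hasSum (wold_hasSum h1 f)
  refine hs.unique ?_
  have hz : ∀ n : ℕ, inner ℂ m (S₂ ((S₁ ^ n) (f n : H))) = 0 := by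
    intro n
    have hcn : S₂ * S₁ ^ n = S₁ ^ n * S₂ := (show Commute S₂ S₁ from hc.symm).pow_right n
    rw [← mul_apply_eq_comp, hcn, mul_apply_eq_comp, ← ContinuousLinearMap.adjoint_inner_left]
    have hm' := invariantFor_adjoint_pow h1.invariantFor_hyperRange_adjoint n m hm
    exact (Submodule.isOrtho_iff_inner_eq.1 h.symm) _ hm' _ ⟨_, (f n).2, rfl⟩
  simp only [hz]
  exact hasSum_zero

theorem pow_apply_adjoint_pow_of_mem_hyperRange {T : H →L[ℂ] H} (hT : IsIsometryOp T) {x : H}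
    (hx : x ∈ hyperRange T) (n : ℕ) : (T ^ n) ((adjoint T ^ n) x) = x := by
  obtain ⟨y, rfl⟩ := mem_hyperRange_iff.1 hx n
  rw [hT.adjoint_pow_apply]

/-- With `y` the projection of `S₂ x`, the bounded backward orbit `S₁*ⁿ y`, `n ≥ 1`, lives in a
finite-dimensional space and hence in a compact ball, which supplies the recurrence. -/
theorem isOrtho_of_finiteDimensional [CompleteSpace (hyperRange S₁)] (hS : IsBiIsometry S₁ S₂)
    (h : ∀ x ∈ (adjoint S₁).ker,
      FiniteDimensional ℂ ((adjointOrbitSpan S₁ S₂ x).map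
        ((hyperRange S₁).starProjection : H →ₗ[ℂ] H))) :
    ((adjoint S₁).ker.map (S₂ : H →ₗ[ℂ] H)) ⟂ hyperRange S₁ := by
  refine isOrtho_map_ker_of_starProjection_eq_zero fun x hx => ?_
  refine eq_zero_of_recurrent (tendsto_inner_pow_starProjection hS hx) fun ε hε N => ?_
  obtain ⟨hc, h1, h2⟩ := hS
  have hfin := h x hx
  set D := (adjointOrbitSpan S₁ S₂ x).map ((hyperRange S₁).starProjection : H →ₗ[ℂ] H) with hD
  set y := (hyperRange S₁).starProjection (S₂ x) with hy
  have hyM : y ∈ hyperRange S₁ := Submodule.starProjection_apply_mem _ _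
  have hinv := h1.invariantFor_hyperRange_adjoint
  have hinv' := h1.reduces_hyperRange.1.orthogonal_adjoint
  have hproj : ∀ n, (adjoint S₁ ^ n) y =
      (hyperRange S₁).starProjection ((adjoint S₁ ^ n) (S₂ x)) := fun n =>
    (InvariantFor.starProjection_apply (hinv.pow n) (hinv'.pow n) _).symm
  have hmem : ∀ n, (adjoint S₁ ^ (n + 1)) y ∈ D := by
    intro n
    rw [hproj]
    exact ⟨_, Submodule.le_topologicalClosure _ (Submodule.subset_span ⟨n + 1, by omega, rfl⟩), rfl⟩
  have : ProperSpace D := FiniteDimensional.proper ℂ D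
  obtain ⟨j, k, hk, hjk⟩ := exists_gap_lt_of_isCompact
    (isCompact_closedBall (0 : D) ‖y‖) (u := fun n => ⟨(adjoint S₁ ^ (n + 1)) y, hmem n⟩)
    (fun n => by
      rw [mem_closedBall_zero_iff]
      exact h1.norm_adjoint_pow_le (n + 1) y) hε N
  refine ⟨k, hk, ?_⟩
  have hjk' : dist ((adjoint S₁ ^ (j + k + 1)) y) ((adjoint S₁ ^ (j + 1)) y) < ε := hjk
  -- Applying `S₁ ^ (j + k + 1)`, which undoes adjoint powers on the hyper-range, turns closeness of
  -- the backward orbit points into closeness of `S₁ᵏ y` and `y`.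
  rw [dist_eq_norm, ← (h1.pow (j + k + 1)).norm_map, map_sub,
    pow_apply_adjoint_pow_of_mem_hyperRange h1 hyM, show j + k + 1 = k + (j + 1) by ring,
    pow_add S₁, mul_apply_eq_comp, pow_apply_adjoint_pow_of_mem_hyperRange h1 hyM,
    norm_sub_rev] at hjk'
  exact hjk'

/-- The compact block maps the bounded sequence `S₁ⁿ x` in the complement to the forward orbit `S₁ⁿ
y`, where `y` is the projection of `S₂ x`. That orbit thus lies in a compact set. -/
theorem isOrtho_of_isCompactOperator [CompleteSpace (hyperRange S₁)] (hS : IsBiIsometry S₁ S₂)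
    (h : IsCompactOperator (blockOp (hyperRange S₁)ᗮ (hyperRange S₁) S₂)) :
    ((adjoint S₁).ker.map (S₂ : H →ₗ[ℂ] H)) ⟂ hyperRange S₁ := by
  refine isOrtho_map_ker_of_starProjection_eq_zero fun x hx => ?_
  refine eq_zero_of_recurrent (tendsto_inner_pow_starProjection hS hx) fun ε hε N => ?_
  obtain ⟨hc, h1, h2⟩ := hS
  have hR := h1.reduces_hyperRange
  have hmem : ∀ n, (S₁ ^ n) x ∈ (hyperRange S₁)ᗮ := by
    intro n
    rw [← range_wold h1]
    exact ⟨lp.single 2 n ⟨x, hx⟩, wold_single h1 n ⟨x, hx⟩⟩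
  obtain ⟨C, hC, hsub⟩ := h.image_closedBall_subset_compact
    (f := (blockOp (hyperRange S₁)ᗮ (hyperRange S₁) S₂ : (hyperRange S₁)ᗮ →ₗ[ℂ] hyperRange S₁)) ‖x‖
  obtain ⟨j, k, hk, hjk⟩ := exists_gap_lt_of_isCompact hC
    (u := fun n => blockOp (hyperRange S₁)ᗮ (hyperRange S₁) S₂ ⟨(S₁ ^ n) x, hmem n⟩)
    (fun n => hsub ⟨_, by
      rw [mem_closedBall_zero_iff]
      exact ((h1.pow n).norm_map x).le, rfl⟩) hε N
  refine ⟨k, hk, ?_⟩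
  have hval : ∀ n, ((blockOp (hyperRange S₁)ᗮ (hyperRange S₁) S₂ ⟨(S₁ ^ n) x, hmem n⟩ :
      hyperRange S₁) : H) = (S₁ ^ n) ((hyperRange S₁).starProjection (S₂ x)) := by
    intro n
    have hcn : S₂ * S₁ ^ n = S₁ ^ n * S₂ := (show Commute S₂ S₁ from hc.symm).pow_right n
    rw [← InvariantFor.starProjection_apply (hR.1.pow n) (hR.2.pow n)]
    have e : (S₁ ^ n) (S₂ x) = S₂ ((S₁ ^ n) x) := by
      rw [← mul_apply_eq_comp, ← hcn, mul_apply_eq_comp]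
    rw [e]
    rfl
  rw [Subtype.dist_eq, hval, hval, dist_eq_norm, pow_add, mul_apply_eq_comp, ← map_sub,
    (h1.pow j).norm_map] at hjk
  exact hjk

theorem isOrtho_of_reduces (h1 : IsIsometryOp S₁) (h : Reduces (hyperRange S₁) S₂) :
    ((adjoint S₁).ker.map (S₂ : H →ₗ[ℂ] H)) ⟂ hyperRange S₁ := by
  rw [Submodule.isOrtho_iff_le]
  rintro _ ⟨x, hx, rfl⟩
  refine h.2 x ?_
  rw [← range_wold h1]
  exact ⟨lp.single 2 0 ⟨x, hx⟩, wold_single h1 0 ⟨x, hx⟩⟩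

/-- The complement of the hyper-range is closed, contains `S₂ x` and is invariant for `S₁*`, so it
contains the whole closed span. -/
theorem map_starProjection_adjointOrbitSpan_eq_bot
    [CompleteSpace (hyperRange S₁)] (h1 : IsIsometryOp S₁)
    (h : ((adjoint S₁).ker.map (S₂ : H →ₗ[ℂ] H)) ⟂ hyperRange S₁) {x : H}
    (hx : x ∈ (adjoint S₁).ker) :
    (adjointOrbitSpan S₁ S₂ x).map ((hyperRange S₁).starProjection : H →ₗ[ℂ] H) = ⊥ := by
  have hle : adjointOrbitSpan S₁ S₂ x ≤ (hyperRange S₁)ᗮ := by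
    refine Submodule.topologicalClosure_minimal _ (Submodule.span_le.2 ?_)
      (Submodule.isClosed_orthogonal _)
    rintro _ ⟨k, -, rfl⟩
    exact h1.reduces_hyperRange.1.orthogonal_adjoint.pow k _
      (Submodule.isOrtho_iff_le.1 h ⟨x, hx, rfl⟩)
  rw [eq_bot_iff]
  rintro _ ⟨v, hv, rfl⟩
  exact (Submodule.mem_bot ℂ).2 ((Submodule.starProjection_apply_eq_zero_iff _).2 (hle hv))

theorem essentiallyReducesToIsometry_of_reduces
    [CompleteSpace (hyperRange S₁)] (h2 : IsIsometryOp S₂)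
    (h : Reduces (hyperRange S₁) S₂) : EssentiallyReducesToIsometry (hyperRange S₁) S₂ := by
  have e1 : blockOp (hyperRange S₁)ᗮ (hyperRange S₁) S₂ = 0 := by
    ext x
    exact (Submodule.starProjection_apply_eq_zero_iff _).2 (h.2 x x.2)
  have e2 : blockOp (hyperRange S₁) (hyperRange S₁)ᗮ S₂ = 0 := by
    ext x
    refine (Submodule.starProjection_apply_eq_zero_iff _).2 ?_
    rw [Submodule.orthogonal_orthogonal]
    exact h.1 x x.2
  have e3 : blockOp (hyperRange S₁) (hyperRange S₁) S₂ = restrictOp (hyperRange S₁) S₂ h.1 := by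
    ext x
    exact Submodule.starProjection_eq_self_iff.2 (h.1 x x.2)
  refine ⟨⟨?_, ?_⟩, ?_⟩
  · rw [e1]; exact isCompactOperator_zero
  · rw [e2]; exact isCompactOperator_zero
  · rw [e3]; exact h2.restrictOp h.1

theorem reducesToDoublyCommutingBiIsometry_of_reduces
    [CompleteSpace (hyperRange S₁)] (hS : IsBiIsometry S₁ S₂)
    (h : Reduces (hyperRange S₁) S₂) :
    ReducesToDoublyCommutingBiIsometry (hyperRange S₁) S₁ S₂ := by
  obtain ⟨hc, h1, h2⟩ := hS
  have hR := h1.reduces_hyperRange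
  have hcomm : restrictOp (hyperRange S₁) S₁ hR.1 * restrictOp (hyperRange S₁) S₂ h.1 =
      restrictOp (hyperRange S₁) S₂ h.1 * restrictOp (hyperRange S₁) S₁ hR.1 := by
    ext x
    exact congrArg (fun A : H →L[ℂ] H => A x) hc
  have hU := restrictOp_mem_unitary h1 hR.1 h1.invariantFor_hyperRange_adjoint
    fun x hx => h1.apply_adjoint_of_mem_hyperRange hx
  exact ⟨hR, h, ⟨hcomm, h1.restrictOp _, h2.restrictOp _⟩, hcomm,
    adjoint_mul_eq_of_commute_unitary hU hcomm⟩

end Criteria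

/-! ### Assembly of the equivalences and the model. -/

theorem theorem1p2 {H : Type u} [NormedAddCommGroup H] [InnerProductSpace ℂ H] [CompleteSpace H]
    (S₁ S₂ : H →L[ℂ] H) (hS : IsBiIsometry S₁ S₂) :
    haveI : CompleteSpace (hyperRange S₁) := hS.2.1.completeSpace_hyperRange
    List.TFAE [
      ReducesToIsometry (hyperRange S₁) S₂,
      ReducesToDoublyCommutingBiIsometry (hyperRange S₁) S₁ S₂,
      ((adjoint S₁).ker.map (S₂ : H →ₗ[ℂ] H)) ⟂ hyperRange S₁,
      ∀ x ∈ (adjoint S₁).ker,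
        FiniteDimensional ℂ ((adjointOrbitSpan S₁ S₂ x).map
          ((hyperRange S₁).starProjection : H →ₗ[ℂ] H)),
      EssentiallyReducesToIsometry (hyperRange S₁) S₂] ∧
    (ReducesToIsometry (hyperRange S₁) S₂ →
      ∃ (φ : ℂ → ((adjoint S₁).ker →L[ℂ] (adjoint S₁).ker))
        (F : Type u) (_ : NormedAddCommGroup F) (_ : InnerProductSpace ℂ F) (_ : CompleteSpace F)
        (ψ : ℂ → (F →L[ℂ] F))
        (Huu : Submodule ℂ H) (_ : CompleteSpace Huu)
        (V₁ V₂ : Huu →L[ℂ] Huu)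
        (Mψ MzF : HardySpace F →L[ℂ] HardySpace F)
        (MzE Mφ : HardySpace (adjoint S₁).ker →L[ℂ] HardySpace (adjoint S₁).ker),
        IsInner φ ∧ IsConstUnitary ψ ∧ Huu ≤ hyperRange S₁ ∧ IsBiUnitary V₁ V₂ ∧
        IsMulOp ψ Mψ ∧ IsMulOp (coordFun F) MzF ∧
        IsMulOp (coordFun (adjoint S₁).ker) MzE ∧ IsMulOp φ Mφ ∧
        PairUnitarilyEquivalent S₁ S₂
          (opSum V₁ (opSum Mψ MzE)) (opSum V₂ (opSum MzF Mφ))) := by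
  have : CompleteSpace (hyperRange S₁) := hS.2.1.completeSpace_hyperRange
  have h12 : ReducesToIsometry (hyperRange S₁) S₂ →
      ReducesToDoublyCommutingBiIsometry (hyperRange S₁) S₁ S₂ :=
    fun h => reducesToDoublyCommutingBiIsometry_of_reduces hS h.1
  have h21 : ReducesToDoublyCommutingBiIsometry (hyperRange S₁) S₁ S₂ →
      ReducesToIsometry (hyperRange S₁) S₂ :=
    fun ⟨_, hB, hb, _⟩ => ⟨hB, hb.2.2⟩
  refine ⟨?_, fun h => exists_model hS h.1⟩
  tfae_have 1 → 2 := h12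
  tfae_have 2 → 1 := h21
  tfae_have 1 → 3 := fun h => isOrtho_of_reduces hS.2.1 h.1
  tfae_have 3 → 1 := fun h => ⟨reduces_of_isOrtho hS h, hS.2.2.restrictOp _⟩
  tfae_have 3 → 4 := by
    intro h x hx
    rw [map_starProjection_adjointOrbitSpan_eq_bot hS.2.1 h hx]
    infer_instance
  tfae_have 4 → 3 := isOrtho_of_finiteDimensional hS
  tfae_have 1 → 5 := fun h => essentiallyReducesToIsometry_of_reduces hS.2.2 h.1
  tfae_have 5 → 3 := fun h => isOrtho_of_isCompactOperator hS h.1.1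
  tfae_finish
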